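/- All graphs are finite and simple. An edge coloring of a graph $H$ is proper if any two distinct edges with a common endvertex have different colors. The color-line graph $\mathrm{CL}(H)$ of an edge-colored graph $H$ has the edges of $H$ as its vertices, and two distinct edges of $H$ are adjacent in $\mathrm{CL}(H)$ if they have a common endvertex or the same color. A graph $G$ is a proper $k$-color-line graph if $G$ is isomorphic to $\mathrm{CL}(H)$ for some graph $H$ that is properly edge-colored with at most $k$ colors; such an edge-colored graph $H$ is called a properly edge $k$-colored root graph of $G$. Theorem. Let $k\ge 1$ be a fixed integer. On a unit-cost word RAM with words of $O(\log n)$ bits there is an algorithm that decides, for a graph $G$ with $n$ vertices and $m$ edges given by $n$ and a list of its edges, whether $G$ is a proper $k$-color-line graph, in time $O(n^{k+4}(n+m)+1)$, that is, $O(n^{k+4}(n+m))$ for $n\ge 1$. Moreover, if $G$ is a proper $k$-color-line graph, then the algorithm also finds, within the same time, a properly edge $k$-colored root graph $H$ of $G$, together with the edge of $H$ that corresponds to each vertex of $G$. The program and the constants in the $O$-terms depend only on $k$. -/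

import Mathlib

/-! ## Color-line graphs -/

/-- An edge coloring `φ` of `H` is proper if any two distinct incident edges get distinct colors
(adjacency in `H.lineGraph` means: distinct and with a common endvertex). -/
def IsProperEdgeColoring {V C : Type*} (H : SimpleGraph V) (φ : H.edgeSet → C) : Prop :=
  ∀ e f : H.edgeSet, H.lineGraph.Adj e f → φ e ≠ φ f

/-- The color-line graph of the edge-colored graph `(H, φ)`: its vertices are the edges of `H`, and
two distinct edges are adjacent if they are incident in `H` or have the same color. -/
def colorLineGraph {V C : Type*} (H : SimpleGraph V) (φ : H.edgeSet → C) :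
    SimpleGraph H.edgeSet where
  Adj e f := e ≠ f ∧ ((∃ v : V, v ∈ (e : Sym2 V) ∧ v ∈ (f : Sym2 V)) ∨ φ e = φ f)
  symm := ⟨fun _ _ h => ⟨h.1.symm, h.2.imp (fun ⟨v, hv⟩ => ⟨v, hv.2, hv.1⟩) Eq.symm⟩⟩
  loopless := ⟨fun _ h => h.1 rfl⟩

/-- `G` is a proper `k`-color-line graph: it is isomorphic to the color-line graph of a finite simple
graph that is properly edge-colored with at most `k` colors. -/
def IsProperColorLineGraph {U : Type*} (k : ℕ) (G : SimpleGraph U) : Prop :=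
  ∃ (V : Type) (_ : Finite V) (H : SimpleGraph V) (φ : H.edgeSet → Fin k),
    IsProperEdgeColoring H φ ∧ Nonempty (G ≃g colorLineGraph H φ)

/-! ## The machine model: unit-cost word RAM

Programs are while-programs over finitely many word registers and finitely many arrays of words.
All words have to be smaller than a bound `W` (that is, they have `log₂ W` bits): an operation whose
result is not smaller than `W` has no execution.  Every register access, array access, arithmetic
operation, comparison, assignment and test costs one step. -/

namespace WordRAM

/-- The memory: registers `reg x` and arrays `arr a`. A program mentions only finitely many
register names and array names. -/
structure State where
  reg : ℕ → ℕ
  arr : ℕ → ℕ → ℕ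

/-- Assign `v` to register `x`. -/
def State.setReg (s : State) (x v : ℕ) : State :=
  { s with reg := Function.update s.reg x v }

/-- Assign `v` to the entry with index `i` of array `a`. -/
def State.setArr (s : State) (a i v : ℕ) : State :=
  { s with arr := Function.update s.arr a (Function.update (s.arr a) i v) }

/-- The elementary operations on words. -/
inductive BinOp where
  | add | sub | mul | div | mod | lt | eq

/-- Subtraction is truncated at `0`, the quotient by `0` is `0`, and comparisons return `1` for
true and `0` for false. -/
def BinOp.apply : BinOp → ℕ → ℕ → ℕ
  | .add, a, b => a + b
  | .sub, a, b => a - b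
  | .mul, a, b => a * b
  | .div, a, b => a / b
  | .mod, a, b => a % b
  | .lt, a, b => if a < b then 1 else 0
  | .eq, a, b => if a = b then 1 else 0

/-- Expressions: constants, registers, array entries, elementary operations. -/
inductive Exp where
  | const (c : ℕ)
  | reg (x : ℕ)
  | load (a : ℕ) (i : Exp)
  | bin (o : BinOp) (e f : Exp)

/-- The value of an expression. -/
def Exp.value (s : State) : Exp → ℕ
  | .const c => c
  | .reg x => s.reg x
  | .load a i => s.arr a (i.value s)
  | .bin o e f => o.apply (e.value s) (f.value s)

/-- All values that occur in the evaluation of an expression are words, i.e. smaller than `W`. -/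
def Exp.Fits (W : ℕ) (s : State) : Exp → Prop
  | .const c => c < W
  | .reg x => s.reg x < W
  | .load a i => i.Fits W s ∧ s.arr a (i.value s) < W
  | .bin o e f => e.Fits W s ∧ f.Fits W s ∧ o.apply (e.value s) (f.value s) < W

/-- The cost of the evaluation of an expression: one step for each constant, register, array access
and elementary operation in it. -/
def Exp.cost : Exp → ℕ
  | .const _ => 1
  | .reg _ => 1
  | .load _ i => i.cost + 1
  | .bin _ e f => e.cost + f.cost + 1

/-- While-programs. A condition is true if its value is not `0`. -/
inductive Prog where
  | skip
  | assign (x : ℕ) (e : Exp)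
  | store (a : ℕ) (i e : Exp)
  | seq (p q : Prog)
  | ite (e : Exp) (p q : Prog)
  | while (e : Exp) (p : Prog)

/-- `Exec W p s s' t`: with words smaller than `W`, the program `p` started in state `s` halts in
state `s'` after exactly `t` steps. -/
inductive Exec (W : ℕ) : Prog → State → State → ℕ → Prop
  | skip (s : State) : Exec W .skip s s 1
  | assign (x : ℕ) (e : Exp) (s : State) (he : e.Fits W s) :
      Exec W (.assign x e) s (s.setReg x (e.value s)) (e.cost + 1)
  | store (a : ℕ) (i e : Exp) (s : State) (hi : i.Fits W s) (he : e.Fits W s) :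
      Exec W (.store a i e) s (s.setArr a (i.value s) (e.value s)) (i.cost + e.cost + 1)
  | seq (p q : Prog) (s s' s'' : State) (t t' : ℕ)
      (hp : Exec W p s s' t) (hq : Exec W q s' s'' t') :
      Exec W (.seq p q) s s'' (t + t')
  | iteTrue (e : Exp) (p q : Prog) (s s' : State) (t : ℕ) (he : e.Fits W s)
      (h : e.value s ≠ 0) (hp : Exec W p s s' t) :
      Exec W (.ite e p q) s s' (e.cost + 1 + t)
  | iteFalse (e : Exp) (p q : Prog) (s s' : State) (t : ℕ) (he : e.Fits W s)
      (h : e.value s = 0) (hq : Exec W q s s' t) :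
      Exec W (.ite e p q) s s' (e.cost + 1 + t)
  | whileTrue (e : Exp) (p : Prog) (s s' s'' : State) (t t' : ℕ) (he : e.Fits W s)
      (h : e.value s ≠ 0) (hp : Exec W p s s' t) (hq : Exec W (.while e p) s' s'' t') :
      Exec W (.while e p) s s'' (e.cost + 1 + t + t')
  | whileFalse (e : Exp) (p : Prog) (s : State) (he : e.Fits W s) (h : e.value s = 0) :
      Exec W (.while e p) s s (e.cost + 1)

end WordRAM

/-! ## Input and output -/

/-- `L` lists the edges of `G`: every edge exactly once, in any order and in any orientation. -/
def IsEdgeList {n : ℕ} (G : SimpleGraph (Fin n)) (L : List (Fin n × Fin n)) : Prop :=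
  (L.map fun p => s(p.1, p.2)).Nodup ∧
    ∀ e : Sym2 (Fin n), e ∈ (L.map fun p => s(p.1, p.2)) ↔ e ∈ G.edgeSet

/-- The initial state for a graph with vertices `0, …, n - 1` and edge list `L`: register `0`
contains `n`, register `1` contains the number of edges, arrays `0` and `1` contain the first and
the second endvertices of the edges, and everything else is `0`. -/
def inputState (n : ℕ) (L : List (Fin n × Fin n)) : WordRAM.State where
  reg x := if x = 0 then n else if x = 1 then L.length else 0
  arr a i :=
    if a = 0 then (L[i]?).elim 0 (fun p => p.1.val)
    else if a = 1 then (L[i]?).elim 0 (fun p => p.2.val)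
    else 0

/-- The state `s` describes a properly edge `k`-colored root graph `H` of `G`: register `1` contains
the number `p` of vertices of `H`, arrays `0` and `1` contain at index `i` the endvertices of the
edge of `H` that corresponds to the vertex `i` of `G`, and array `2` contains at index `i` the color
of that edge. -/
def OutputsRoot (k : ℕ) {n : ℕ} (G : SimpleGraph (Fin n)) (s : WordRAM.State) : Prop :=
  ∃ (H : SimpleGraph (Fin (s.reg 1))) (φ : H.edgeSet → Fin k) (ι : G ≃g colorLineGraph H φ),
    IsProperEdgeColoring H φ ∧
      ∀ i : Fin n, (ι i : Sym2 (Fin (s.reg 1))).map Fin.val = s(s.arr 0 i, s.arr 1 i) ∧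
        (φ (ι i) : ℕ) = s.arr 2 i

/-! ## A language of bounded loops -/

namespace WordRAM

/-! In a properly colored graph `H`, edges of one color are pairwise disjoint. Hence the color
classes are cliques of the color-line graph, and an edge between two different classes means exactly
incidence in `H`. So `G` is a proper `k`-color-line graph iff its vertices split into at most `k`
cliques such that the edges between different cliques (`crossGraph`) form the line graph of a simple
graph. Two tasks remain: find the partition and recognize the line graph.

The partition. A vertex has at most two neighbors in every other class, one at each end. Hence
vertices of different colors have at most `2 * k` common neighbors, while two vertices of one class
with at least `2 * k + 3` elements have more. Send `v` to the smallest vertex that is `v` itself or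
has more than `2 * k` common neighbors with `v`. This preserves the color (`IsRep.col_eq`), a large
class has only one representative, and a small class has at most `2 * k + 2`
(`IsRep.card_image_le`). A partition is thus determined by the colors of at most `(2 * k + 2) * k`
representatives (`exists_decode`), and the number of candidates depends only on `k`.

The line graph. Give every vertex `v` two ends `0` and `1`, and let `x v w` be the end at which `v`
meets its neighbor `w`. Two nonadjacent neighbors of `v` meet it in different ends. If neighbors
`w`, `u` are adjacent, the three edges form a star or a triangle, so `x v w = x v u` iff `x w v = x
w u`. These conditions are linear over the field with two elements. Every root graph yields a
solution (`IsProperColorLineGraph.exists_coloring`). Conversely, a solution makes `SameEnd` an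
equivalence relation, whose classes serve as vertices of a root graph (`IsEndSystem.exists_root`).

The time. There are `n ^ 2` unknowns and at most `n ^ 3` equations, each eliminated in `O(n ^ 4)`
steps (`solves_addEquation`). The total `n ^ 7` is at most `n ^ (k + 5)` for `k ≥ 2`. For `k = 1`
there are no edges between classes, the equations are skipped, and the other parts take `O(n ^ 4)`.
Since `n ^ (k + 5) ≤ n ^ (k + 4) * (n + m)`, the number of edges plays no further role.

The machine. The algorithm is a program with bounded loops, which has a total semantics `den`.
Correctness is proved for `den` with loop invariants (`den_loop`), and `exists_exec` transfers it to
the word RAM together with the time bound. -/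

instance : Add Exp := ⟨.bin .add⟩
instance : Sub Exp := ⟨.bin .sub⟩
instance : Mul Exp := ⟨.bin .mul⟩
instance : Div Exp := ⟨.bin .div⟩
instance : Mod Exp := ⟨.bin .mod⟩
instance (c : ℕ) : OfNat Exp c := ⟨.const c⟩

section
variable (s : State) (e f : Exp)

@[simp] theorem Exp.value_add : (e + f).value s = e.value s + f.value s := rfl
@[simp] theorem Exp.value_sub : (e - f).value s = e.value s - f.value s := rfl
@[simp] theorem Exp.value_mul : (e * f).value s = e.value s * f.value s := rfl
@[simp] theorem Exp.value_div : (e / f).value s = e.value s / f.value s := rfl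
@[simp] theorem Exp.value_mod : (e % f).value s = e.value s % f.value s := rfl
@[simp] theorem Exp.value_two : (2 : Exp).value s = 2 := rfl
@[simp] theorem Exp.value_zero : (0 : Exp).value s = 0 := rfl
@[simp] theorem Exp.value_one : (1 : Exp).value s = 1 := rfl
@[simp] theorem Exp.value_const (c : ℕ) : (Exp.const c).value s = c := rfl
@[simp] theorem Exp.value_reg (x : ℕ) : (Exp.reg x).value s = s.reg x := rfl
@[simp] theorem Exp.value_load (a : ℕ) : (Exp.load a e).value s = s.arr a (e.value s) := rfl
@[simp] theorem Exp.value_lt :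
    (Exp.bin .lt e f).value s = if e.value s < f.value s then 1 else 0 := rfl
@[simp] theorem Exp.value_eq :
    (Exp.bin .eq e f).value s = if e.value s = f.value s then 1 else 0 := rfl

@[simp] theorem State.setReg_reg (x v y : ℕ) :
    (s.setReg x v).reg y = if y = x then v else s.reg y := by
  simp [State.setReg, Function.update_apply]

@[simp] theorem State.setReg_arr (x v : ℕ) : (s.setReg x v).arr = s.arr := rfl

@[simp] theorem State.setArr_reg (a i v : ℕ) : (s.setArr a i v).reg = s.reg := rfl

@[simp] theorem State.setArr_arr (a i v b j : ℕ) :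
    (s.setArr a i v).arr b j = if b = a ∧ j = i then v else s.arr b j := by
  by_cases hb : b = a
  · subst hb
    simp [State.setArr, Function.update_apply]
  · simp [State.setArr, hb]

theorem State.setArr_arr_of_ne {a b : ℕ} (h : b ≠ a) (i v : ℕ) :
    (s.setArr a i v).arr b = s.arr b := by
  simp [State.setArr, h]

end

/-- Programs whose loops are bounded: `loop x c d p` executes `p` with the values
`0, …, c * n ^ d - 1` of the register `x`, where `n` is the content of the register `0`. -/
inductive LoopProg where
  | skip
  | assign (x : ℕ) (e : Exp)
  | store (a : ℕ) (i e : Exp)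
  | seq (p q : LoopProg)
  | ite (e : Exp) (p q : LoopProg)
  | loop (x c d : ℕ) (p : LoopProg)

namespace LoopProg

/-- The states reached by executing `f` with `x = 0, x = 1, …`. -/
def iter (f : State → State) (x : ℕ) (s : State) : ℕ → State
  | 0 => s.setReg x 0
  | i + 1 => (f (iter f x s i)).setReg x (i + 1)

/-- The state in which a program ends. All assigned values are reduced modulo `M`. -/
def den (n M : ℕ) : LoopProg → State → State
  | .skip => fun s => s
  | .assign x e => fun s => s.setReg x (e.value s % M)
  | .store a i e => fun s => s.setArr a (i.value s) (e.value s % M)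
  | .seq p q => fun s => den n M q (den n M p s)
  | .ite e p q => fun s => if e.value s = 0 then den n M q s else den n M p s
  | .loop x c d p => fun s => iter (den n M p) x s (c * n ^ d)

/-- The registers that a program may change. -/
def regs : LoopProg → List ℕ
  | .skip => []
  | .assign x _ => [x]
  | .store _ _ _ => []
  | .seq p q => p.regs ++ q.regs
  | .ite _ p q => p.regs ++ q.regs
  | .loop x _ _ p => x :: p.regs

/-- The arrays that a program may change. -/
def arrs : LoopProg → List ℕ
  | .skip => []
  | .assign _ _ => []
  | .store a _ _ => [a]
  | .seq p q => p.arrs ++ q.arrs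
  | .ite _ p q => p.arrs ++ q.arrs
  | .loop _ _ _ p => p.arrs

/-- The exponent of `n` in the running time. -/
def depth : LoopProg → ℕ
  | .skip => 0
  | .assign _ _ => 0
  | .store _ _ _ => 0
  | .seq p q => max p.depth q.depth
  | .ite _ p q => max p.depth q.depth
  | .loop _ c d p => if c = 0 then 0 else d + p.depth

/-- The registers `0` and `1` are not changed, loop counters are not changed by the body of the loop,
and loop bounds are smaller than `(n + 2) ^ a`. -/
def WF (a : ℕ) : LoopProg → Prop
  | .skip => True
  | .assign x _ => 2 ≤ x
  | .store _ _ _ => True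
  | .seq p q => p.WF a ∧ q.WF a
  | .ite _ p q => p.WF a ∧ q.WF a
  | .loop x c d p => 2 ≤ x ∧ x ∉ p.regs ∧ c + d ≤ a ∧ p.WF a

/-- The expression `e ^ d`. -/
def powExp (e : Exp) : ℕ → Exp
  | 0 => .const 1
  | d + 1 => powExp e d * e

/-- The while-program for a program with bounded loops. -/
def compile (a : ℕ) : LoopProg → Prog
  | .skip => .skip
  | .assign x e => .assign x (e % powExp (.reg 0 + .const 2) a)
  | .store b i e => .store b i (e % powExp (.reg 0 + .const 2) a)
  | .seq p q => .seq (p.compile a) (q.compile a)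
  | .ite e p q => .ite e (p.compile a) (q.compile a)
  | .loop x c d p =>
      .seq (.assign x (.const 0)) (.while (.bin .lt (.reg x) (.const c * powExp (.reg 0) d))
        (.seq (p.compile a) (.assign x (.reg x + .const 1))))

theorem powExp_value (e : Exp) (s : State) (d : ℕ) : (powExp e d).value s = e.value s ^ d := by
  induction d with
  | zero => rfl
  | succ d ih => simp [powExp, ih, pow_succ]

end LoopProg

/-- All registers and array entries are smaller than `M`. -/
def State.Bounded (M : ℕ) (s : State) : Prop :=
  (∀ x, s.reg x < M) ∧ ∀ a i, s.arr a i < M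

theorem State.Bounded.setReg {M : ℕ} {s : State} (hs : s.Bounded M) {x v : ℕ} (hv : v < M) :
    (s.setReg x v).Bounded M := by
  refine ⟨fun y => ?_, hs.2⟩
  rw [State.setReg_reg]
  split_ifs
  exacts [hv, hs.1 y]

theorem State.Bounded.setArr {M : ℕ} {s : State} (hs : s.Bounded M) {a i v : ℕ} (hv : v < M) :
    (s.setArr a i v).Bounded M := by
  refine ⟨hs.1, fun b j => ?_⟩
  rw [State.setArr_arr]
  split_ifs
  exacts [hv, hs.2 b j]

/-- The base `n + 2` is at least `2` even for `n = 0`, so every constant of a program is absorbed by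
an exponent that does not depend on `n`. -/
theorem lt_add_two_pow (c n : ℕ) : c < (n + 2) ^ c :=
  Nat.lt_pow_self (by omega)

theorem BinOp.apply_lt (o : BinOp) {x y X Y : ℕ} (n : ℕ) (hx : x < X) (hy : y < Y) :
    o.apply x y < X * Y * (n + 2) := by
  have hXY : X * Y * 2 ≤ X * Y * (n + 2) := Nat.mul_le_mul_left _ (by omega)
  have h1 : X ≤ X * Y := Nat.le_mul_of_pos_right _ (by omega)
  have h2 : Y ≤ X * Y := Nat.le_mul_of_pos_left _ (by omega)
  cases o with
  | add => simp only [BinOp.apply]; omega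
  | sub => simp only [BinOp.apply]; omega
  | mul =>
    have := Nat.mul_lt_mul'' hx hy
    simp only [BinOp.apply]; omega
  | div =>
    have := Nat.div_le_self x y
    simp only [BinOp.apply]; omega
  | mod =>
    have := Nat.mod_le x y
    simp only [BinOp.apply]; omega
  | lt => simp only [BinOp.apply]; split_ifs <;> omega
  | eq => simp only [BinOp.apply]; split_ifs <;> omega

/-- An elementary operation at most multiplies the bounds of its arguments, up to a factor `n + 2 ≥
2` that covers sums and comparisons. The exponent depends only on `a` and the expression, which is
why words of `O(log n)` bits suffice. -/
theorem Exp.exists_fits (a : ℕ) (e : Exp) : ∃ d, ∀ (n : ℕ) (s : State), s.Bounded ((n + 2) ^ a) →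
    e.value s < (n + 2) ^ d ∧ ∀ w, d ≤ w → e.Fits ((n + 2) ^ w) s := by
  have mono : ∀ {n i j : ℕ}, i ≤ j → (n + 2) ^ i ≤ (n + 2) ^ j :=
    fun h => Nat.pow_le_pow_right (by omega) h
  induction e with
  | const c =>
    exact ⟨c, fun n s _ => ⟨lt_add_two_pow c n, fun w hw => (lt_add_two_pow c n).trans_le (mono hw)⟩⟩
  | reg x => exact ⟨a, fun n s hs => ⟨hs.1 x, fun w hw => (hs.1 x).trans_le (mono hw)⟩⟩
  | load b i ih =>
    obtain ⟨d, hd⟩ := ih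
    refine ⟨max d a, fun n s hs => ⟨(hs.2 _ _).trans_le (mono (le_max_right _ _)), fun w hw =>
      ⟨(hd n s hs).2 w ((le_max_left _ _).trans hw),
        (hs.2 _ _).trans_le (mono ((le_max_right _ _).trans hw))⟩⟩⟩
  | bin o e f ihe ihf =>
    obtain ⟨d, hd⟩ := ihe
    obtain ⟨d', hd'⟩ := ihf
    have key : ∀ (n : ℕ) (s : State), s.Bounded ((n + 2) ^ a) →
        (Exp.bin o e f).value s < (n + 2) ^ (d + d' + 1) := fun n s hs => by
      have := BinOp.apply_lt o n (hd n s hs).1 (hd' n s hs).1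
      rwa [← pow_add, ← pow_succ] at this
    exact ⟨d + d' + 1, fun n s hs => ⟨key n s hs, fun w hw =>
      ⟨(hd n s hs).2 w (by omega), (hd' n s hs).2 w (by omega), (key n s hs).trans_le (mono hw)⟩⟩⟩

/-! ### Semantics of bounded loops and their running time. -/

namespace LoopProg

theorem iter_reg_self (f : State → State) (x : ℕ) (s : State) (i : ℕ) :
    (iter f x s i).reg x = i := by
  cases i <;> simp [iter]

theorem den_reg (n M : ℕ) (p : LoopProg) {y : ℕ} (hy : y ∉ p.regs) (s : State) :
    (den n M p s).reg y = s.reg y := by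
  induction p generalizing s with
  | skip => rfl
  | assign x e => simp_all [den, regs]
  | store a i e => rfl
  | seq p q ihp ihq =>
    simp only [regs, List.mem_append, not_or] at hy
    simp [den, ihp hy.1, ihq hy.2]
  | ite e p q ihp ihq =>
    simp only [regs, List.mem_append, not_or] at hy
    simp only [den]
    split_ifs
    exacts [ihq hy.2 s, ihp hy.1 s]
  | loop x c d p ih =>
    simp only [regs, List.mem_cons, not_or] at hy
    simp only [den]
    induction c * n ^ d with
    | zero => simp [iter, hy.1]
    | succ i h => simp [iter, hy.1, ih hy.2, h]

theorem den_arr (n M : ℕ) (p : LoopProg) {b : ℕ} (hb : b ∉ p.arrs) (s : State) :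
    (den n M p s).arr b = s.arr b := by
  induction p generalizing s with
  | skip => rfl
  | assign x e => rfl
  | store a i e =>
    simp only [arrs, List.mem_singleton] at hb
    exact State.setArr_arr_of_ne _ hb _ _
  | seq p q ihp ihq =>
    simp only [arrs, List.mem_append, not_or] at hb
    simp [den, ihp hb.1, ihq hb.2]
  | ite e p q ihp ihq =>
    simp only [arrs, List.mem_append, not_or] at hb
    simp only [den]
    split_ifs
    exacts [ihq hb.2 s, ihp hb.1 s]
  | loop x c d p ih =>
    simp only [arrs] at hb
    simp only [den]
    induction c * n ^ d with
    | zero => simp [iter]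
    | succ i h => simp [iter, ih hb, h]

/-- The rule for loops. -/
theorem den_loop {n M x c d : ℕ} {p : LoopProg} {s : State} (q : LoopProg) (N : ℕ)
    (hq : q = .loop x c d p) (hN : N = c * n ^ d) (I : ℕ → State → Prop)
    (h0 : I 0 (s.setReg x 0))
    (hI : ∀ i < N, ∀ s' : State, I i s' → s'.reg x = i → (∀ y, y ∉ q.regs → s'.reg y = s.reg y) →
      (∀ b, b ∉ q.arrs → s'.arr b = s.arr b) → I (i + 1) ((den n M p s').setReg x (i + 1))) :
    I N (den n M q s) := by
  subst hq hN
  have key : ∀ i ≤ c * n ^ d, I i (iter (den n M p) x s i) ∧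
      (∀ y, y ∉ (LoopProg.loop x c d p).regs → (iter (den n M p) x s i).reg y = s.reg y) ∧
      (∀ b, b ∉ p.arrs → (iter (den n M p) x s i).arr b = s.arr b) := by
    intro i
    induction i with
    | zero =>
      refine fun _ => ⟨h0, fun y hy => ?_, fun b _ => rfl⟩
      simp only [regs, List.mem_cons, not_or] at hy
      simp [iter, hy.1]
    | succ i ih =>
      intro hi
      obtain ⟨h1, h2, h3⟩ := ih (by omega)
      refine ⟨hI i (by omega) _ h1 (iter_reg_self _ _ _ _) h2 h3, fun y hy => ?_, fun b hb => ?_⟩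
      · rw [← h2 y hy]
        simp only [regs, List.mem_cons, not_or] at hy
        simp [iter, hy.1, den_reg n M p hy.2]
      · rw [← h3 b hb]
        simp [iter, den_arr n M p hb]
  exact (key _ le_rfl).1

/-- Loop counters are not reduced modulo `(n + 2) ^ a`; this estimate keeps them small all the same.
-/
theorem loop_bound_lt {n a c d : ℕ} (h : c + d ≤ a) : c * n ^ d < (n + 2) ^ a := by
  calc c * n ^ d ≤ c * (n + 2) ^ d := Nat.mul_le_mul_left _ (Nat.pow_le_pow_left (by omega) _)
    _ < (n + 2) ^ c * (n + 2) ^ d :=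
      Nat.mul_lt_mul_of_pos_right (lt_add_two_pow c n) (by positivity)
    _ = (n + 2) ^ (c + d) := (pow_add _ _ _).symm
    _ ≤ (n + 2) ^ a := Nat.pow_le_pow_right (by omega) h

theorem den_bounded {n a : ℕ} (p : LoopProg) (hp : p.WF a) {s : State}
    (hs : s.Bounded ((n + 2) ^ a)) : (den n ((n + 2) ^ a) p s).Bounded ((n + 2) ^ a) := by
  have hM : 0 < (n + 2) ^ a := by positivity
  induction p generalizing s with
  | skip => exact hs
  | assign x e => exact hs.setReg (Nat.mod_lt _ hM)
  | store b i e => exact hs.setArr (Nat.mod_lt _ hM)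
  | seq p q ihp ihq => exact ihq hp.2 (ihp hp.1 hs)
  | ite e p q ihp ihq =>
    simp only [den]
    split_ifs
    exacts [ihq hp.2 hs, ihp hp.1 hs]
  | loop x c d p ih =>
    exact den_loop _ _ rfl rfl (fun _ s => s.Bounded _) (hs.setReg hM) fun i hi s' hs' _ _ _ =>
      (ih hp.2.2.2 hs').setReg ((Nat.succ_le_of_lt hi).trans_lt (loop_bound_lt hp.2.2.1))

theorem zero_notMem_regs {a : ℕ} (p : LoopProg) (hp : p.WF a) : 0 ∉ p.regs := by
  induction p with
  | skip => simp [regs]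
  | assign x e => simp only [WF] at hp; simp [regs]; omega
  | store b i e => simp [regs]
  | seq p q ihp ihq => simp [regs, ihp hp.1, ihq hp.2]
  | ite e p q ihp ihq => simp [regs, ihp hp.1, ihq hp.2]
  | loop x c d p ih =>
    have := hp.1
    simp [regs, ih hp.2.2.2]; omega

/-- A program with bounded loops runs on the word RAM in time `O(n ^ depth)`, with words of
`O(log n)` bits. -/
theorem exists_exec (a : ℕ) (p : LoopProg) (hp : p.WF a) : ∃ w C : ℕ, ∀ (n W : ℕ) (s : State),
    s.reg 0 = n → s.Bounded ((n + 2) ^ a) → w ≤ W → ∃ t ≤ C * (n + 1) ^ p.depth,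
      Exec ((n + 2) ^ W) (p.compile a) s (den n ((n + 2) ^ a) p s) t := by
  induction p with
  | skip => exact ⟨0, 1, fun n W s _ _ _ => ⟨1, by simp [depth], .skip s⟩⟩
  | assign x e =>
    obtain ⟨d, hd⟩ := Exp.exists_fits a (e % powExp (.reg 0 + .const 2) a)
    refine ⟨d, (e % powExp (.reg 0 + .const 2) a).cost + 1, fun n W s hn hs hw =>
      ⟨(e % powExp (.reg 0 + .const 2) a).cost + 1, by simp [depth], ?_⟩⟩
    · have := Exec.assign x _ s ((hd n s hs).2 W hw)
      simpa [powExp_value, hn, compile, den] using this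
  | store b i e =>
    obtain ⟨d, hd⟩ := Exp.exists_fits a (e % powExp (.reg 0 + .const 2) a)
    obtain ⟨d', hd'⟩ := Exp.exists_fits a i
    refine ⟨max d d', i.cost + (e % powExp (.reg 0 + .const 2) a).cost + 1, fun n W s hn hs hw =>
      ⟨i.cost + (e % powExp (.reg 0 + .const 2) a).cost + 1, by simp [depth], ?_⟩⟩
    · have := Exec.store b i _ s ((hd' n s hs).2 W ((le_max_right _ _).trans hw))
        ((hd n s hs).2 W ((le_max_left _ _).trans hw))
      simpa [powExp_value, hn, compile, den] using this
  | seq p q ihp ihq =>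
    obtain ⟨w, C, h⟩ := ihp hp.1
    obtain ⟨w', C', h'⟩ := ihq hp.2
    refine ⟨max w w', C + C', fun n W s hn hs hw => ?_⟩
    obtain ⟨t, ht, H⟩ := h n W s hn hs ((le_max_left _ _).trans hw)
    obtain ⟨t', ht', H'⟩ := h' n W (den n ((n + 2) ^ a) p s)
      (by rw [den_reg _ _ _ (zero_notMem_regs p hp.1), hn]) (den_bounded p hp.1 hs)
      ((le_max_right _ _).trans hw)
    refine ⟨t + t', ?_, .seq _ _ _ _ _ _ _ H H'⟩
    have h1 : (n + 1) ^ p.depth ≤ (n + 1) ^ max p.depth q.depth :=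
      Nat.pow_le_pow_right (by omega) (le_max_left _ _)
    have h2 : (n + 1) ^ q.depth ≤ (n + 1) ^ max p.depth q.depth :=
      Nat.pow_le_pow_right (by omega) (le_max_right _ _)
    simp only [depth, add_mul]
    exact add_le_add (ht.trans (Nat.mul_le_mul_left _ h1)) (ht'.trans (Nat.mul_le_mul_left _ h2))
  | ite e p q ihp ihq =>
    obtain ⟨w, C, h⟩ := ihp hp.1
    obtain ⟨w', C', h'⟩ := ihq hp.2
    obtain ⟨d, hd⟩ := Exp.exists_fits a e
    refine ⟨max d (max w w'), e.cost + 1 + C + C', fun n W s hn hs hw => ?_⟩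
    have h1 : (n + 1) ^ p.depth ≤ (n + 1) ^ max p.depth q.depth :=
      Nat.pow_le_pow_right (by omega) (le_max_left _ _)
    have h2 : (n + 1) ^ q.depth ≤ (n + 1) ^ max p.depth q.depth :=
      Nat.pow_le_pow_right (by omega) (le_max_right _ _)
    have h3 : (e.cost + 1) * 1 ≤ (e.cost + 1) * (n + 1) ^ max p.depth q.depth :=
      Nat.mul_le_mul_left _ (Nat.one_le_pow _ _ (by omega))
    have hf := (hd n s hs).2 W ((le_max_left _ _).trans hw)
    simp only [depth, add_mul _ C, add_mul _ C', den, compile]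
    by_cases he : e.value s = 0
    · obtain ⟨t, ht, H⟩ := h' n W s hn hs (by omega)
      refine ⟨_, ?_, by simpa [he] using Exec.iteFalse e _ _ s _ _ hf he H⟩
      have := ht.trans (Nat.mul_le_mul_left _ h2)
      omega
    · obtain ⟨t, ht, H⟩ := h n W s hn hs (by omega)
      refine ⟨_, ?_, by simpa [he] using Exec.iteTrue e _ _ s _ _ hf he H⟩
      have := ht.trans (Nat.mul_le_mul_left _ h1)
      omega
  | loop x c d p ih =>
    obtain ⟨hx, hxp, hcd, hp⟩ := hp
    obtain ⟨w, C, h⟩ := ih hp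
    set cond : Exp := .bin .lt (.reg x) (.const c * powExp (.reg 0) d) with hcond
    obtain ⟨d₁, hd₁⟩ := Exp.exists_fits a cond
    obtain ⟨d₂, hd₂⟩ := Exp.exists_fits a (.reg x + .const 1)
    -- The summand `cond.cost + 3` pays for the initial assignment (2 steps) and the final failing
    -- test. The remainder pays for the iterations.
    refine ⟨max (max d₁ d₂) w, cond.cost + 3 + c * (cond.cost + 5 + C), fun n W s hn hs hw => ?_⟩
    set M := (n + 2) ^ a with hM
    have hM0 : 0 < M := by positivity
    have hbound : c * n ^ d < M := loop_bound_lt hcd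
    have inv : ∀ i ≤ c * n ^ d, (iter (den n M p) x s i).reg 0 = n ∧
        (iter (den n M p) x s i).Bounded M := by
      intro i
      induction i with
      | zero => exact fun _ => ⟨by simp [iter, hn]; omega, hs.setReg hM0⟩
      | succ i hi =>
        intro hle
        obtain ⟨h1, h2⟩ := hi (by omega)
        refine ⟨?_, (den_bounded p hp h2).setReg (by omega)⟩
        have : (0 : ℕ) ≠ x := by omega
        simp [iter, this, den_reg n M p (zero_notMem_regs p hp), h1]
    set body : Prog := .seq (p.compile a) (.assign x (.reg x + .const 1)) with hbody
    -- Besides the body, an iteration costs `cond.cost + 1` for the test and `4` for incrementing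
    -- the counter.
    set step := cond.cost + 5 + C * (n + 1) ^ p.depth with hstep
    -- Induction on the number `j` of remaining iterations, because a while-loop unfolds from its
    -- first iteration.
    have run : ∀ j i, i + j = c * n ^ d → ∃ t ≤ cond.cost + 1 + j * step,
        Exec ((n + 2) ^ W) (.while cond body) (iter (den n M p) x s i)
          (iter (den n M p) x s (c * n ^ d)) t := by
      intro j
      induction j with
      | zero =>
        intro i hi
        obtain ⟨h1, h2⟩ := inv i (by omega)
        obtain rfl : i = c * n ^ d := by omega
        refine ⟨cond.cost + 1, by omega, .whileFalse _ _ _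
          ((hd₁ n _ h2).2 W ((le_max_left _ _).trans ((le_max_left _ _).trans hw))) ?_⟩
        simp [hcond, iter_reg_self, powExp_value, h1]
      | succ j hj =>
        intro i hi
        obtain ⟨h1, h2⟩ := inv i (by omega)
        obtain ⟨t, ht, H⟩ := hj (i + 1) (by omega)
        obtain ⟨t', ht', H'⟩ := h n W _ h1 h2 ((le_max_right _ _).trans hw)
        have h3 := den_bounded p hp h2
        have hval : (den n M p (iter (den n M p) x s i)).reg x = i := by
          rw [den_reg n M p hxp, iter_reg_self]
        have H'' := Exec.assign x _ (den n M p (iter (den n M p) x s i))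
          ((hd₂ n _ h3).2 W ((le_max_right _ _).trans ((le_max_left _ _).trans hw)))
        simp only [Exp.value_add, Exp.value_reg, hval, Exp.value_const] at H''
        refine ⟨_, ?_, .whileTrue _ _ _ _ _ _ _
          ((hd₁ n _ h2).2 W ((le_max_left _ _).trans ((le_max_left _ _).trans hw))) ?_
          (.seq _ _ _ _ _ _ _ H' H'') H⟩
        · have hc : (Exp.reg x + Exp.const 1).cost = 3 := rfl
          rw [hc, add_mul]
          omega
        · have : i < c * n ^ d := by omega
          simp [hcond, iter_reg_self, powExp_value, h1, this]
    obtain ⟨t, ht, H⟩ := run (c * n ^ d) 0 (by omega)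
    refine ⟨2 + t, ?_, .seq _ _ _ _ _ _ _ (.assign x (.const 0) s ?_) H⟩
    · simp only [depth]
      split_ifs with hc
      · subst hc
        simp only [zero_mul, add_zero, pow_zero, mul_one] at ht ⊢
        omega
      · have h0 : 1 ≤ (n + 1) ^ (d + p.depth) := Nat.one_le_pow _ _ (by omega)
        have h1 : 1 ≤ (n + 1) ^ p.depth := Nat.one_le_pow _ _ (by omega)
        have h2 : step ≤ (cond.cost + 5 + C) * (n + 1) ^ p.depth := by
          rw [hstep, add_mul (cond.cost + 5)]
          have := Nat.mul_le_mul_left (cond.cost + 5) h1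
          omega
        have h3 : c * n ^ d * step ≤ c * (cond.cost + 5 + C) * (n + 1) ^ (d + p.depth) := by
          calc c * n ^ d * step
              ≤ c * (n + 1) ^ d * ((cond.cost + 5 + C) * (n + 1) ^ p.depth) :=
                Nat.mul_le_mul (Nat.mul_le_mul_left _ (Nat.pow_le_pow_left (by omega) _)) h2
            _ = _ := by rw [pow_add]; ring
        have h4 := Nat.mul_le_mul_left (cond.cost + 3) h0
        rw [add_mul]
        omega
    · exact pow_pos (by omega) _

end LoopProg

end WordRAM

/-! ## Line graphs and linear equations over the field with two elements -/

/-- The edges of `G` between vertices of different colors. -/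
def crossGraph {V : Type*} (G : SimpleGraph V) (col : V → ℕ) : SimpleGraph V where
  Adj v w := G.Adj v w ∧ col v ≠ col w
  symm := ⟨fun _ _ h => ⟨h.1.symm, h.2.symm⟩⟩
  loopless := ⟨fun _ h => h.2 rfl⟩

/-- The vertices of equal color are pairwise adjacent. -/
def IsCliqueColoring {V : Type*} (G : SimpleGraph V) (col : V → ℕ) : Prop :=
  ∀ v w, v ≠ w → col v = col w → G.Adj v w

/-- The linear equations that express that `B` is the line graph of a graph, in which the edge `v`
has two ends `0` and `1`, and meets the adjacent edge `w` in its end `x v w`. -/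
def IsEndSystem {V : Type*} (B : SimpleGraph V) (x : V → V → ZMod 2) : Prop :=
  ∀ v w u, B.Adj v w → B.Adj v u → w ≠ u →
    (B.Adj w u → x v w + x v u + x w v + x w u = 0) ∧ (¬ B.Adj w u → x v w + x v u + 1 = 0)

theorem ZMod.add_add_one_eq_zero_iff (a b : ZMod 2) : a + b + 1 = 0 ↔ a ≠ b := by
  revert a b; decide

theorem ZMod.add_add_add_eq_zero_iff (a b c d : ZMod 2) : a + b + c + d = 0 ↔ (a = b ↔ c = d) := by
  revert a b c d; decide

theorem ZMod.two_cases (a : ZMod 2) : a = 0 ∨ a = 1 := by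
  revert a; decide

/-- The end `q.2` of `q.1` and the end `r.2` of `r.1` are the same vertex. -/
def SameEnd {V : Type*} (B : SimpleGraph V) (x : V → V → ZMod 2) (q r : V × ZMod 2) : Prop :=
  q = r ∨ B.Adj q.1 r.1 ∧ x q.1 r.1 = q.2 ∧ x r.1 q.1 = r.2

theorem SameEnd.symm {V : Type*} {B : SimpleGraph V} {x : V → V → ZMod 2} {q r : V × ZMod 2}
    (h : SameEnd B x q r) : SameEnd B x r q :=
  h.imp Eq.symm fun h => ⟨h.1.symm, h.2.2, h.2.1⟩

/-- If `v` and `u` meet `w` in the same end, the equation for nonadjacent neighbors forces `v` and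
`u` to be adjacent. The equations for adjacent neighbors then say that `v` meets `w` and `u` in one
end, and `u` meets `v` and `w` in one end. -/
theorem IsEndSystem.sameEnd_trans {V : Type*} {B : SimpleGraph V} {x : V → V → ZMod 2}
    (hx : IsEndSystem B x) {q r t : V × ZMod 2} (h : SameEnd B x q r) (h' : SameEnd B x r t) :
    SameEnd B x q t := by
  obtain ⟨v, a⟩ := q
  obtain ⟨w, b⟩ := r
  obtain ⟨u, c⟩ := t
  rcases h with h | ⟨h1, h2, h3⟩
  · rwa [h]
  rcases h' with h' | ⟨h1', h2', h3'⟩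
  · rw [← h']; exact .inr ⟨h1, h2, h3⟩
  simp only at h1 h2 h3 h1' h2' h3'
  by_cases hvu : v = u
  · subst hvu
    exact .inl (by rw [← h2, ← h3'])
  obtain ⟨h4, h5⟩ := hx w v u h1.symm h1' hvu
  obtain ⟨h6, -⟩ := hx w u v h1' h1.symm (Ne.symm hvu)
  simp only [ZMod.add_add_one_eq_zero_iff, ZMod.add_add_add_eq_zero_iff] at h4 h5 h6
  have hadj : B.Adj v u := by
    by_contra hn
    exact h5 hn (h3.trans h2'.symm)
  refine .inr ⟨hadj, ?_, ?_⟩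
  · rw [← h2]; exact ((h4 hadj).1 (h3.trans h2'.symm)).symm
  · rw [← h3']; exact ((h6 hadj.symm).1 (h2'.trans h3.symm)).symm

/-- The numbers of the ends that are the same vertex as `q`. -/
def endClass {n : ℕ} (B : SimpleGraph (Fin n)) (x : Fin n → Fin n → ZMod 2)
    (q : Fin n × ZMod 2) : Set ℕ :=
  {y | ∃ r : Fin n × ZMod 2, SameEnd B x q r ∧ y = 2 * r.1 + r.2.val}

theorem ZMod.val_two_le_one (a : ZMod 2) : a.val ≤ 1 :=
  Nat.le_of_lt_succ a.val_lt

/-- The number `2 * r + a` determines the end `a` of `r`, so two classes with the same minimum have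
a common member. Minima of classes can therefore serve as names of the vertices of the root graph.
-/
theorem IsEndSystem.eq_iff_sameEnd {n : ℕ} {B : SimpleGraph (Fin n)}
    {x : Fin n → Fin n → ZMod 2} (hx : IsEndSystem B x) {e : Fin n → ZMod 2 → ℕ}
    (he : ∀ v a, IsLeast (endClass B x (v, a)) (e v a)) (v w : Fin n) (a b : ZMod 2) :
    e v a = e w b ↔ SameEnd B x (v, a) (w, b) := by
  constructor
  · intro h
    obtain ⟨⟨u, c⟩, h1, h2⟩ := (he v a).1
    obtain ⟨⟨u', c'⟩, h3, h4⟩ := (he w b).1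
    simp only at h2 h4
    have hc := ZMod.val_two_le_one c
    have hc' := ZMod.val_two_le_one c'
    have hu : u = u' := Fin.ext (by omega)
    have hcc : c = c' := ZMod.val_injective 2 (by omega)
    subst hu hcc
    exact hx.sameEnd_trans h1 h3.symm
  · intro h
    have : endClass B x (v, a) = endClass B x (w, b) := Set.ext fun y =>
      ⟨fun ⟨r, hr, hy⟩ => ⟨r, hx.sameEnd_trans h.symm hr, hy⟩,
        fun ⟨r, hr, hy⟩ => ⟨r, hx.sameEnd_trans h hr, hy⟩⟩
    exact (he v a).unique (this ▸ he w b)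

/-- A partition into cliques together with a solution of the linear equations yields a properly
edge colored root graph. -/
theorem IsEndSystem.exists_root {n k p : ℕ} {G : SimpleGraph (Fin n)} {col : Fin n → ℕ}
    (hk : ∀ v, col v < k) (hcol : IsCliqueColoring G col) {x : Fin n → Fin n → ZMod 2}
    (hx : IsEndSystem (crossGraph G col) x) {e : Fin n → ZMod 2 → ℕ}
    (he : ∀ v a, IsLeast (endClass (crossGraph G col) x (v, a)) (e v a)) (hp : p = 2 * n) :
    ∃ (H : SimpleGraph (Fin p)) (φ : H.edgeSet → Fin k) (ι : G ≃g colorLineGraph H φ),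
      IsProperEdgeColoring H φ ∧
        ∀ i : Fin n, (ι i : Sym2 (Fin p)).map Fin.val = s(e i 0, e i 1) ∧
          (φ (ι i) : ℕ) = col i := by
  have hlt : ∀ v a, e v a < p := fun v a => by
    obtain ⟨⟨u, c⟩, -, h2⟩ := (he v a).1
    have := ZMod.val_two_le_one c
    have := u.isLt
    simp only at h2
    omega
  have heq := hx.eq_iff_sameEnd he
  set E : Fin n → Sym2 (Fin p) := fun v => s(⟨e v 0, hlt v 0⟩, ⟨e v 1, hlt v 1⟩) with hE
  have mem_E : ∀ v z, z ∈ E v ↔ ∃ a, z = ⟨e v a, hlt v a⟩ := fun v z => by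
    rw [hE, Sym2.mem_iff]
    refine ⟨fun h => h.elim (fun h => ⟨0, h⟩) fun h => ⟨1, h⟩, fun ⟨a, ha⟩ => ?_⟩
    rcases ZMod.two_cases a with rfl | rfl
    exacts [.inl ha, .inr ha]
  have ne_ends : ∀ v, e v 0 ≠ e v 1 := fun v h => by
    rcases (heq v v 0 1).1 h with h | ⟨h, -⟩
    · exact absurd (congrArg Prod.snd h) (zero_ne_one (α := ZMod 2))
    · exact (crossGraph G col).loopless.irrefl v h
  have meet : ∀ v w, v ≠ w → ((∃ z, z ∈ E v ∧ z ∈ E w) ↔ (crossGraph G col).Adj v w) := by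
    intro v w hvw
    constructor
    · rintro ⟨z, hz, hz'⟩
      obtain ⟨a, rfl⟩ := (mem_E _ _).1 hz
      obtain ⟨b, hb⟩ := (mem_E _ _).1 hz'
      rcases (heq v w a b).1 (Fin.mk.inj hb) with h | h
      · exact absurd (congrArg Prod.fst h) hvw
      · exact h.1
    · intro h
      refine ⟨⟨e v (x v w), hlt _ _⟩, (mem_E _ _).2 ⟨_, rfl⟩, (mem_E _ _).2 ⟨x w v, ?_⟩⟩
      exact Fin.ext ((heq _ _ _ _).2 (.inr ⟨h, rfl, rfl⟩))
  have inj : Function.Injective E := by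
    intro v w h
    by_contra hvw
    -- Equal edges would share both ends, but `x v w` names only one end of `v`.
    have key : ∀ a, x v w = a := fun a => by
      have : (⟨e v a, hlt v a⟩ : Fin p) ∈ E w := h ▸ (mem_E _ _).2 ⟨a, rfl⟩
      obtain ⟨b, hb⟩ := (mem_E _ _).1 this
      rcases (heq v w a b).1 (Fin.mk.inj hb) with h | h
      · exact absurd (congrArg Prod.fst h) hvw
      · exact h.2.1
    exact absurd ((key 0).symm.trans (key 1)) (by decide)
  set H : SimpleGraph (Fin p) := SimpleGraph.fromEdgeSet (Set.range E)
  have hH : H.edgeSet = Set.range E := by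
    rw [SimpleGraph.edgeSet_fromEdgeSet]
    refine sdiff_eq_left.2 (Set.disjoint_left.2 ?_)
    rintro _ ⟨v, rfl⟩ hd
    exact ne_ends v (Fin.mk.inj (Sym2.mk_isDiag_iff.1 hd))
  set ι : Fin n ≃ H.edgeSet := (Equiv.ofInjective E inj).trans (Equiv.setCongr hH.symm)
  have hι : ∀ v, (ι v : Sym2 (Fin p)) = E v := fun v => rfl
  set φ : H.edgeSet → Fin k := fun f => ⟨col (ι.symm f), hk _⟩
  have hφι : ∀ v, (φ (ι v) : ℕ) = col v := fun v => by
    change col (ι.symm (ι v)) = col v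
    rw [ι.symm_apply_apply]
  refine ⟨H, φ, ⟨ι, ?_⟩, ?_, fun i => ⟨congrArg (Sym2.map Fin.val) (hι i), hφι i⟩⟩
  · intro v w
    change (ι v ≠ ι w ∧ ((∃ z, z ∈ (ι v : Sym2 (Fin p)) ∧ z ∈ (ι w : Sym2 (Fin p))) ∨
      φ (ι v) = φ (ι w))) ↔ G.Adj v w
    rw [hι, hι, Fin.ext_iff, hφι, hφι, ι.injective.ne_iff]
    constructor
    · rintro ⟨hne, h | h⟩
      · exact ((meet v w hne).1 h).1
      · exact hcol v w hne h
    · intro h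
      refine ⟨h.ne, ?_⟩
      by_cases hc : col v = col w
      · exact .inr hc
      · exact .inl ((meet v w h.ne).2 ⟨h, hc⟩)
  · intro f g hfg
    obtain ⟨v, rfl⟩ := ι.surjective f
    obtain ⟨w, rfl⟩ := ι.surjective g
    rw [SimpleGraph.lineGraph_adj_iff_exists, hι, hι, ι.injective.ne_iff] at hfg
    have := ((meet v w hfg.1).1 hfg.2).2
    rwa [← hφι v, ← hφι w, Fin.val_ne_iff] at this

/-- A proper `k`-color-line graph has a partition into `k` cliques such that every vertex has at most
two neighbors in each of the other cliques, and the linear equations have a solution. -/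
theorem IsProperColorLineGraph.exists_coloring {U : Type*} {k : ℕ} {G : SimpleGraph U}
    (h : IsProperColorLineGraph k G) : ∃ col : U → ℕ, (∀ v, col v < k) ∧ IsCliqueColoring G col ∧
      (∀ v c, c ≠ col v → {w | G.Adj v w ∧ col w = c}.encard ≤ 2) ∧
      ∃ x, IsEndSystem (crossGraph G col) x := by
  classical
  obtain ⟨V, -, H, φ, hφ, ⟨ι⟩⟩ := h
  have hadj : ∀ v w, G.Adj v w ↔ v ≠ w ∧
      ((∃ z, z ∈ (ι v : Sym2 V) ∧ z ∈ (ι w : Sym2 V)) ∨ φ (ι v) = φ (ι w)) := fun v w => by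
    rw [← ι.map_adj_iff, ← ι.injective.ne_iff]; rfl
  have proper : ∀ v w z, v ≠ w → z ∈ (ι v : Sym2 V) → z ∈ (ι w : Sym2 V) → φ (ι v) ≠ φ (ι w) :=
    fun v w z hvw hv hw => hφ _ _
      (SimpleGraph.lineGraph_adj_iff_exists.2 ⟨ι.injective.ne hvw, z, hv, hw⟩)
  have ends : ∀ v, ∃ q : ZMod 2 → V, q 0 ≠ q 1 ∧ ∀ z, z ∈ (ι v : Sym2 V) ↔ ∃ a, z = q a := by
    intro v
    obtain ⟨f, hf⟩ := ι v
    induction f with | _ a b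
    refine ⟨fun i => if i = 0 then a else b, ?_, fun z => ?_⟩
    · simpa using SimpleGraph.Adj.ne hf
    · simp only [Sym2.mem_iff]
      refine ⟨fun h => h.elim (fun h => ⟨0, by simpa⟩) fun h => ⟨1, by simpa⟩, fun ⟨i, hi⟩ => ?_⟩
      split_ifs at hi
      exacts [.inl hi, .inr hi]
  choose q hq0 hq using ends
  have qinj : ∀ v a b, q v a = q v b → a = b := fun v a b h => by
    have := hq0 v
    rcases ZMod.two_cases a with rfl | rfl <;> rcases ZMod.two_cases b with rfl | rfl <;>
      first | rfl | exact absurd h this | exact absurd h.symm this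
  -- In a simple graph two distinct edges share at most one vertex.
  have uniq : ∀ v w z z', v ≠ w → z ∈ (ι v : Sym2 V) → z ∈ (ι w : Sym2 V) →
      z' ∈ (ι v : Sym2 V) → z' ∈ (ι w : Sym2 V) → z = z' := by
    intro v w z z' hvw h1 h2 h3 h4
    by_contra hz
    exact hvw (ι.injective (Subtype.ext
      (((Sym2.mem_and_mem_iff hz).1 ⟨h1, h3⟩).trans ((Sym2.mem_and_mem_iff hz).1 ⟨h2, h4⟩).symm)))
  set col : U → ℕ := fun v => φ (ι v) with hcol
  have cross : ∀ v w, (crossGraph G col).Adj v w ↔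
      v ≠ w ∧ ∃ z, z ∈ (ι v : Sym2 V) ∧ z ∈ (ι w : Sym2 V) := by
    intro v w
    simp only [crossGraph, hadj, hcol, ne_eq, ← Fin.ext_iff]
    constructor
    · rintro ⟨⟨h1, h2⟩, h3⟩
      exact ⟨h1, h2.resolve_right h3⟩
    · rintro ⟨h1, z, h2, h3⟩
      exact ⟨⟨h1, .inl ⟨z, h2, h3⟩⟩, proper v w z h1 h2 h3⟩
  refine ⟨col, fun v => (φ (ι v)).isLt, fun v w hvw h => (hadj v w).2 ⟨hvw, .inr (Fin.ext h)⟩, ?_,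
    ?_⟩
  · intro v c hc
    have hex : ∀ w ∈ {w | G.Adj v w ∧ col w = c}, ∃ a, q v a ∈ (ι w : Sym2 V) := by
      rintro w ⟨h1, h2⟩
      obtain ⟨-, z, h3, h4⟩ := (cross v w).1 ⟨h1, fun h => hc (h2.symm.trans h.symm)⟩
      obtain ⟨a, rfl⟩ := (hq v z).1 h3
      exact ⟨a, h4⟩
    choose! f hf using hex
    -- Two edges of color `c` through the same end of `v` would violate properness, so the end
    -- determines the neighbor.
    have hinj : Set.InjOn f {w | G.Adj v w ∧ col w = c} := by
      intro w hw u hu hwu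
      by_contra hne
      refine proper w u (q v (f w)) hne (hf w hw) (hwu ▸ hf u hu) ?_
      exact Fin.ext (hw.2.trans hu.2.symm)
    calc {w | G.Adj v w ∧ col w = c}.encard
        = (f '' {w | G.Adj v w ∧ col w = c}).encard := hinj.encard_image.symm
      _ ≤ (Set.univ : Set (ZMod 2)).encard := Set.encard_le_encard (Set.subset_univ _)
      _ = 2 := by simp [Set.encard_univ, ENat.card_eq_coe_fintype_card, ZMod.card]
  · have hex : ∀ v w, (crossGraph G col).Adj v w → ∃ a, q v a ∈ (ι w : Sym2 V) := by
      intro v w h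
      obtain ⟨-, z, h3, h4⟩ := (cross v w).1 h
      obtain ⟨a, rfl⟩ := (hq v z).1 h3
      exact ⟨a, h4⟩
    choose! x hx using hex
    have hmem : ∀ v a, q v a ∈ (ι v : Sym2 V) := fun v a => (hq v _).2 ⟨a, rfl⟩
    have hsame : ∀ v w, (crossGraph G col).Adj v w → q v (x v w) = q w (x w v) := fun v w h =>
      uniq v w _ _ h.ne (hmem _ _) (hx v w h) (hx w v h.symm) (hmem _ _)
    have common : ∀ v w u, (crossGraph G col).Adj v w → (crossGraph G col).Adj v u →
        (crossGraph G col).Adj w u → x v w = x v u → x w v = x w u := by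
      intro v w u h1 h2 h3 h
      refine qinj w _ _ ?_
      rw [← hsame v w h1]
      exact uniq w u _ _ h3.ne (hx v w h1) (h ▸ hx v u h2) (hmem _ _) (hx w u h3)
    refine ⟨x, fun v w u h1 h2 hwu => ?_⟩
    rw [ZMod.add_add_one_eq_zero_iff, ZMod.add_add_add_eq_zero_iff]
    refine ⟨fun h3 => ⟨common v w u h1 h2 h3, common w v u h1.symm h3 h2⟩, fun h3 h => h3 ?_⟩
    exact (cross w u).2 ⟨hwu, _, hx v w h1, h ▸ hx v u h2⟩

/-! ## Finding the large cliques -/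

section Representatives

open Finset

variable {U : Type*} [Fintype U] {k : ℕ} {G : SimpleGraph U} [DecidableRel G.Adj]
  {col : U → ℕ}

/-- The number of common neighbors. -/
def commonCount (G : SimpleGraph U) [DecidableRel G.Adj] (v w : U) : ℕ :=
  #{u | G.Adj v u ∧ G.Adj w u}

/-- Suppose that the colors differ. Common neighbors of color `col v` are counted at `w`, those of
any other color at `v`, so each of the `k` colors contributes at most two. -/
theorem col_eq_of_commonCount (hk : ∀ v, col v < k)
    (h2 : ∀ v c, c ≠ col v → {w | G.Adj v w ∧ col w = c}.encard ≤ 2) {v w : U}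
    (h : 2 * k < commonCount G v w) : col v = col w := by
  by_contra hne
  have hle : ∀ v c, c ≠ col v → #{u | G.Adj v u ∧ col u = c} ≤ 2 := fun v c hc => by
    have := h2 v c hc
    rw [← Set.coe_toFinset {w | G.Adj v w ∧ col w = c}, Set.encard_coe_eq_coe_finsetCard] at this
    simpa using this
  have : commonCount G v w ≤ 2 * #(range k) := by
    refine card_le_mul_card_image_of_maps_to (f := col) (fun u _ => mem_range.2 (hk u)) 2 ?_
    intro c _
    by_cases hc : c = col v
    · refine (card_le_card fun u hu => ?_).trans (hle w c (hc ▸ hne))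
      simp only [mem_filter, mem_univ, true_and] at hu ⊢
      exact ⟨hu.1.2, hu.2⟩
    · refine (card_le_card fun u hu => ?_).trans (hle v c hc)
      simp only [mem_filter, mem_univ, true_and] at hu ⊢
      exact ⟨hu.1.1, hu.2⟩
  rw [card_range] at this
  omega

/-- All vertices of the class other than `v` and `w` are common neighbors. -/
theorem lt_commonCount [DecidableEq U] (hcol : IsCliqueColoring G col) {v w : U} (h : col v = col w)
    (hc : 2 * k + 3 ≤ #{u | col u = col v}) : 2 * k < commonCount G v w := by
  have hsub : ({u | col u = col v} : Finset U) \ {v, w} ⊆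
      ({u | G.Adj v u ∧ G.Adj w u} : Finset U) := by
    intro u hu
    simp only [mem_sdiff, mem_filter, mem_univ, true_and, mem_insert, mem_singleton,
      not_or] at hu ⊢
    exact ⟨hcol v u (Ne.symm hu.2.1) hu.1.symm,
      hcol w u (Ne.symm hu.2.2) (h.symm.trans hu.1.symm)⟩
  have h1 := card_le_card hsub
  have h2 := le_card_sdiff ({v, w} : Finset U) ({u | col u = col v} : Finset U)
  have h3 : #({v, w} : Finset U) ≤ 2 := card_le_two
  unfold commonCount
  omega

/-- `rep v` is the smallest vertex that is equal to `v` or has many common neighbors with `v`. -/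
def IsRep [LinearOrder U] (k : ℕ) (G : SimpleGraph U) [DecidableRel G.Adj] (rep : U → U) : Prop :=
  ∀ v, IsLeast {w | w = v ∨ 2 * k < commonCount G w v} (rep v)

theorem IsRep.col_eq {U : Type*} [Fintype U] [LinearOrder U] {G : SimpleGraph U}
    [DecidableRel G.Adj] {col : U → ℕ} {rep : U → U} (hrep : IsRep k G rep) (hk : ∀ v, col v < k)
    (h2 : ∀ v c, c ≠ col v → {w | G.Adj v w ∧ col w = c}.encard ≤ 2) (v : U) :
    col (rep v) = col v := by
  rcases (hrep v).1 with h | h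
  · rw [h]
  · exact col_eq_of_commonCount hk h2 h

/-- Count the representatives of each color. A class of at most `2 * k + 2` vertices is no problem.
In a larger class any two vertices have many common neighbors, so each representative is at most
every other one by minimality. -/
theorem IsRep.card_image_le {U : Type*} [Fintype U] [LinearOrder U] {G : SimpleGraph U}
    [DecidableRel G.Adj] {col : U → ℕ} {rep : U → U} (hrep : IsRep k G rep) (hk : ∀ v, col v < k)
    (hcol : IsCliqueColoring G col)
    (h2 : ∀ v c, c ≠ col v → {w | G.Adj v w ∧ col w = c}.encard ≤ 2) :
    #(univ.image rep) ≤ (2 * k + 2) * k := by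
  have := card_le_mul_card_image_of_maps_to (s := univ.image rep) (t := range k) (f := col)
    (fun u _ => mem_range.2 (hk u)) (2 * k + 2) ?_
  · rwa [card_range] at this
  intro c _
  by_cases hc : #{u | col u = c} ≤ 2 * k + 2
  · exact (card_le_card (filter_subset_filter _ (subset_univ _))).trans hc
  · refine (card_le_one.2 fun a ha b hb => ?_).trans (by omega)
    simp only [mem_filter, mem_image, mem_univ, true_and] at ha hb
    obtain ⟨⟨v, rfl⟩, hv⟩ := ha
    obtain ⟨⟨w, rfl⟩, hw⟩ := hb
    have key : ∀ v w, col (rep v) = c → col (rep w) = c → rep v ≤ rep w := fun v w hv hw =>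
      (hrep v).2 <| .inr <| lt_commonCount hcol (by rw [hw, ← hv, hrep.col_eq hk h2]) <| by
        rw [hw]; omega
    exact le_antisymm (key v w hv hw) (key w v hw hv)

end Representatives

/-! ## Solving linear equations over the field with two elements -/

namespace WordRAM.LoopProg

open Exp

infixr:60 " ;; " => WordRAM.LoopProg.seq

section
variable {n M : ℕ} {s : State}

@[simp] theorem den_seq {p q : LoopProg} : den n M (p ;; q) s = den n M q (den n M p s) := rfl
@[simp] theorem den_skip : den n M skip s = s := rfl
@[simp] theorem den_assign {x : ℕ} {e : Exp} :
    den n M (assign x e) s = s.setReg x (e.value s % M) := rfl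
@[simp] theorem den_store {a : ℕ} {i e : Exp} :
    den n M (store a i e) s = s.setArr a (i.value s) (e.value s % M) := rfl
@[simp] theorem den_ite {e : Exp} {p q : LoopProg} :
    den n M (ite e p q) s = if e.value s = 0 then den n M q s else den n M p s := rfl

end

/-- The values of the unknowns in terms of the parameters `z`. The matrix is in array `9`, the
constant terms are in array `10`. -/
def affine (N : ℕ) (s : State) (z : ℕ → ZMod 2) (j : ℕ) : ZMod 2 :=
  ∑ l ∈ Finset.range N, (s.arr 9 (j * N + l) : ZMod 2) * z l + s.arr 10 j

/-- The state describes the solutions of `E`; register `12` is `0` if there is none. -/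
structure Solves (N : ℕ) (E : (ℕ → ZMod 2) → Prop) (s : State) : Prop where
  sound : s.reg 12 ≠ 0 → ∀ z, E (affine N s z)
  complete : ∀ x, E x → ∀ j < N, affine N s x j = x j
  unsolvable : s.reg 12 = 0 → ∀ x, ¬ E x

/-- The linear equation given by the registers `7, …, 11`. -/
def EquationHolds (s : State) (x : ℕ → ZMod 2) : Prop :=
  x (s.reg 7) + x (s.reg 8) + (x (s.reg 9) + x (s.reg 10)) + s.reg 11 = 0

/-- Add rows of the matrix to get the row of coefficients in array `11` of an equation for the
parameters. Register `13` becomes `l + 1` for some `l` with a nonzero coefficient. -/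
def addRows : LoopProg :=
  loop 14 1 2
    (store 11 (reg 14)
      ((load 9 (reg 7 * (reg 0 * reg 0) + reg 14) + load 9 (reg 8 * (reg 0 * reg 0) + reg 14) +
        (load 9 (reg 9 * (reg 0 * reg 0) + reg 14) + load 9 (reg 10 * (reg 0 * reg 0) + reg 14)))
        % 2) ;;
    ite (load 11 (reg 14)) (assign 13 (reg 14 + 1)) skip)

/-- Add a multiple of the row in array `11` to the row with number `reg 14` of the matrix. -/
def substituteRow : LoopProg :=
  loop 17 1 2 (store 9 (reg 14 * (reg 0 * reg 0) + reg 17)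
    ((load 9 (reg 14 * (reg 0 * reg 0) + reg 17) + reg 16 * load 11 (reg 17)) % 2))

/-- Eliminate the parameter with number `reg 13 - 1`. -/
def substitute : LoopProg :=
  loop 14 1 2
    (assign 16 (load 9 (reg 14 * (reg 0 * reg 0) + (reg 13 - 1)) % 2) ;;
    substituteRow ;;
    store 10 (reg 14) ((load 10 (reg 14) + reg 16 * reg 15) % 2))

/-- Take into account one more equation. -/
def addEquation : LoopProg :=
  assign 13 0 ;;
  addRows ;;
  assign 15 ((load 10 (reg 7) + load 10 (reg 8) + (load 10 (reg 9) + load 10 (reg 10)) + reg 11)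
    % 2) ;;
  ite (reg 13) substitute (ite (reg 15) (assign 12 0) skip)

theorem mul_add_inj {N a b c d : ℕ} (hb : b < N) (hd : d < N) :
    a * N + b = c * N + d ↔ a = c ∧ b = d := by
  refine ⟨fun h => ?_, fun ⟨h, h'⟩ => by rw [h, h']⟩
  have h1 : (b + N * a) / N = (d + N * c) / N := by
    congr 1; rw [mul_comm N a, mul_comm N c]; omega
  rw [Nat.add_mul_div_left _ _ (by omega), Nat.add_mul_div_left _ _ (by omega),
    Nat.div_eq_of_lt hb, Nat.div_eq_of_lt hd] at h1
  obtain rfl : a = c := by omega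
  exact ⟨rfl, by omega⟩

theorem mod_two_mod {M : ℕ} (hM : 2 ≤ M) (a : ℕ) : a % 2 % M = a % 2 :=
  Nat.mod_eq_of_lt ((Nat.mod_lt _ (by omega)).trans_le hM)

/-- The shift by one in register `13` lets `0` signal a zero row while position `0` can still be a
pivot. -/
theorem den_addRows {n M : ℕ} {s : State} (hM : n * n + 2 ≤ M) (hn : s.reg 0 = n)
    (h13 : s.reg 13 = 0) :
    (∀ l < n * n, (den n M addRows s).arr 11 l =
      (s.arr 9 (s.reg 7 * (n * n) + l) + s.arr 9 (s.reg 8 * (n * n) + l) +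
        (s.arr 9 (s.reg 9 * (n * n) + l) + s.arr 9 (s.reg 10 * (n * n) + l))) % 2) ∧
    ((den n M addRows s).reg 13 = 0 ∧ (∀ l < n * n, (den n M addRows s).arr 11 l = 0) ∨
      ∃ p < n * n, (den n M addRows s).reg 13 = p + 1 ∧ (den n M addRows s).arr 11 p = 1) := by
  have key := den_loop (n := n) (M := M) (s := s) addRows (n * n) rfl (by ring)
    (fun i s' => (∀ l < i, s'.arr 11 l =
      (s.arr 9 (s.reg 7 * (n * n) + l) + s.arr 9 (s.reg 8 * (n * n) + l) +
        (s.arr 9 (s.reg 9 * (n * n) + l) + s.arr 9 (s.reg 10 * (n * n) + l))) % 2) ∧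
      (s'.reg 13 = 0 ∧ (∀ l < i, s'.arr 11 l = 0) ∨
      ∃ p < i, s'.reg 13 = p + 1 ∧ s'.arr 11 p = 1)) ?_ ?_
  · exact key
  · simp [h13]
  · rintro i hi s' ⟨h1, h2⟩ h14 hr ha
    have r0 := hr 0 (by decide)
    have r7 := hr 7 (by decide)
    have r8 := hr 8 (by decide)
    have r9 := hr 9 (by decide)
    have r10 := hr 10 (by decide)
    have a9 := ha 9 (by decide)
    have hiM : (i + 1) % M = i + 1 := Nat.mod_eq_of_lt (by omega)
    simp only [den_seq, den_store, den_ite, den_assign, den_skip, value_load, value_mod, value_add,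
      value_mul, value_reg, value_two, value_one, h14, r0, r7, r8, r9, r10, a9, hn,
      mod_two_mod (show 2 ≤ M by omega), State.setArr_reg, State.setArr_arr, hiM]
    set v := (s.arr 9 (s.reg 7 * (n * n) + i) + s.arr 9 (s.reg 8 * (n * n) + i) +
        (s.arr 9 (s.reg 9 * (n * n) + i) + s.arr 9 (s.reg 10 * (n * n) + i))) % 2 with hv
    have hv2 : v < 2 := Nat.mod_lt _ (by omega)
    simp only [and_self, if_true]
    constructor
    · intro l hl
      rcases Nat.lt_succ_iff_lt_or_eq.1 hl with hl | rfl
      · split_ifs <;> simp [hl.ne, h1 l hl]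
      · split_ifs <;> simp [hv]
    · split_ifs with h0
      · rcases h2 with ⟨h2, h3⟩ | ⟨p, hp, h3, h4⟩
        · refine .inl ⟨by simpa using h2, fun l hl => ?_⟩
          rcases Nat.lt_succ_iff_lt_or_eq.1 hl with hl | rfl
          · simp [hl.ne, h3 l hl]
          · simp [h0]
        · exact .inr ⟨p, by omega, by simpa using h3, by simpa [hp.ne] using h4⟩
      · exact .inr ⟨i, by omega, by simp, by simp; omega⟩

theorem den_substituteRow {n M : ℕ} {s : State} (hM : 2 ≤ M) (hn : s.reg 0 = n) {j l : ℕ}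
    (hl : l < n * n) : (den n M substituteRow s).arr 9 (j * (n * n) + l) =
      if j = s.reg 14 then (s.arr 9 (j * (n * n) + l) + s.reg 16 * s.arr 11 l) % 2
      else s.arr 9 (j * (n * n) + l) := by
  have key := den_loop (n := n) (M := M) (s := s) substituteRow (n * n) rfl (by ring)
    (fun i s' => ∀ j, ∀ l < n * n, s'.arr 9 (j * (n * n) + l) =
      if j = s.reg 14 ∧ l < i then (s.arr 9 (j * (n * n) + l) + s.reg 16 * s.arr 11 l) % 2
      else s.arr 9 (j * (n * n) + l)) ?_ ?_
  · have := key j l hl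
    simpa [hl] using this
  · simp
  · intro i hi s' h1 h17 hr ha j l hl
    have h1i := h1 (s.reg 14) i hi
    simp only [lt_irrefl, and_false, if_false] at h1i
    simp only [den_store, value_load, value_mod, value_add, value_mul, value_reg, value_two,
      State.setReg_arr, State.setArr_arr, mod_two_mod hM, h17, hr 14 (by decide), hr 0 (by decide),
      hr 16 (by decide), ha 11 (by decide), hn, mul_add_inj hl hi, true_and, h1 j l hl, h1i]
    by_cases hj : j = s.reg 14
    · subst hj
      rcases lt_trichotomy l i with h | rfl | h
      · simp [h, h.ne, h.trans (Nat.lt_succ_self i)]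
      · simp
      · simp [h.ne', show ¬ l < i by omega, show ¬ l < i + 1 by omega]
    · simp [hj]

/-- The pivot entry of a row is saved in register `16` before the row is overwritten, so every
update uses the old entry. -/
theorem den_substitute {n M : ℕ} {s : State} (hM : 2 ≤ M) (hn : s.reg 0 = n) {p : ℕ}
    (hp : p < n * n) (h13 : s.reg 13 = p + 1) {j : ℕ} (hj : j < n * n) :
    (∀ l < n * n, (den n M substitute s).arr 9 (j * (n * n) + l) =
      (s.arr 9 (j * (n * n) + l) + s.arr 9 (j * (n * n) + p) * s.arr 11 l) % 2) ∧
    (den n M substitute s).arr 10 j =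
      (s.arr 10 j + s.arr 9 (j * (n * n) + p) * s.reg 15) % 2 := by
  have key := den_loop (n := n) (M := M) (s := s) substitute (n * n) rfl (by ring)
    (fun i s' => ∀ j < n * n, (∀ l < n * n, s'.arr 9 (j * (n * n) + l) = if j < i then
        (s.arr 9 (j * (n * n) + l) + s.arr 9 (j * (n * n) + p) * s.arr 11 l) % 2
      else s.arr 9 (j * (n * n) + l)) ∧ s'.arr 10 j = if j < i then
        (s.arr 10 j + s.arr 9 (j * (n * n) + p) * s.reg 15) % 2 else s.arr 10 j) ?_ ?_
  · simpa [hj] using key j hj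
  · simp
  · intro i hi s' h1 h14 hr ha j hj
    have h1i := h1 i hi
    simp only [lt_irrefl, if_false] at h1i
    have h13' : s'.reg 13 - 1 = p := by rw [hr 13 (by decide), h13]; omega
    have h0' : s'.reg 0 = n := by rw [hr 0 (by decide), hn]
    simp only [den_seq, den_store, den_assign, value_load, value_mod, value_add, value_sub,
      value_mul, value_reg, value_two, value_one, h13', h14, h0', h1i.1 p hp, mod_two_mod hM]
    set v := s.arr 9 (i * (n * n) + p) with hv
    set s'' := s'.setReg 16 (v % 2) with hs''
    have hrow : ∀ l < n * n, (den n M substituteRow s'').arr 9 (j * (n * n) + l) =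
        if j = i then (s'.arr 9 (j * (n * n) + l) + v * s.arr 11 l) % 2
        else s'.arr 9 (j * (n * n) + l) := fun l hl => by
      rw [den_substituteRow hM (by simp [hs'', h0']) hl]
      simp [hs'', h14, ha 11 (by decide), Nat.add_mod, Nat.mul_mod]
    have r14 : (den n M substituteRow s'').reg 14 = i := by
      rw [den_reg _ _ _ (by decide)]; simp [hs'', h14]
    have r15 : (den n M substituteRow s'').reg 15 = s.reg 15 := by
      rw [den_reg _ _ _ (by decide)]; simp [hs'', hr 15 (by decide)]
    have r16 : (den n M substituteRow s'').reg 16 = v % 2 := by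
      rw [den_reg _ _ _ (by decide)]; simp [hs'']
    have a10 : (den n M substituteRow s'').arr 10 = s'.arr 10 := by
      rw [den_arr _ _ _ (by decide)]; simp [hs'']
    obtain ⟨h2, h3⟩ := h1 j hj
    constructor
    · intro l hl
      simp only [State.setReg_arr, State.setArr_arr, hrow l hl, h2 l hl]
      rcases lt_trichotomy j i with h | rfl | h
      · simp [h, h.ne, h.trans (Nat.lt_succ_self i)]
      · simp [hv]
      · simp [h.ne', show ¬ j < i by omega, show ¬ j < i + 1 by omega]
    · simp only [State.setReg_arr, State.setArr_arr, r14, r15, r16, a10, h1i.2, h3]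
      rcases lt_trichotomy j i with h | rfl | h
      · simp [h, h.ne, h.trans (Nat.lt_succ_self i)]
      · simp [hv, Nat.add_mod, Nat.mul_mod]
      · simp [h.ne', show ¬ j < i by omega, show ¬ j < i + 1 by omega]

theorem cast_mod_two (a : ℕ) : ((a % 2 : ℕ) : ZMod 2) = a := by
  simp

theorem affine_update {N p : ℕ} {s : State} (hp : p < N) (z : ℕ → ZMod 2) (c : ZMod 2) (j : ℕ) :
    affine N s (Function.update z p (z p + c)) j =
      affine N s z j + (s.arr 9 (j * N + p) : ZMod 2) * c := by
  have h : ∀ l ∈ Finset.range N,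
      (s.arr 9 (j * N + l) : ZMod 2) * Function.update z p (z p + c) l =
        (s.arr 9 (j * N + l) : ZMod 2) * z l +
          if p = l then (s.arr 9 (j * N + l) : ZMod 2) * c else 0 := fun l _ => by
    by_cases h : p = l
    · subst h; simp [mul_add]
    · simp [h, Function.update_of_ne (Ne.symm h)]
  rw [affine, affine, Finset.sum_congr rfl h, Finset.sum_add_distrib, Finset.sum_ite_eq,
    if_pos (Finset.mem_range.2 hp)]
  ring

/-- Composed with the affine parametrization, the new equation becomes `r z = 0` for an affine form
`r`. If `r` is constant, the equation is void or contradictory. Otherwise let `p` be a parameter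
with coefficient `1` in `r`, and replace `z p` by `z p + r z`. This changes `r z` to `r z + r z =
0`, so every parameter now gives a solution. A solution `x` is reproduced by the old map, hence `r x
= 0`, and the new map reproduces it too. No back substitution is needed. -/
theorem solves_addEquation {n M : ℕ} {s : State} {E : (ℕ → ZMod 2) → Prop}
    (hM : n * n + 2 ≤ M) (hn : s.reg 0 = n) (h7 : s.reg 7 < n * n) (h8 : s.reg 8 < n * n)
    (h9 : s.reg 9 < n * n) (h10 : s.reg 10 < n * n)
    (hE : ∀ x y, (∀ j < n * n, x j = y j) → E x → E y) (hs : Solves (n * n) E s) :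
    Solves (n * n) (fun x => E x ∧ EquationHolds s x) (den n M addEquation s) := by
  have hM2 : 2 ≤ M := by omega
  set s₁ := s.setReg 13 0 with hs₁
  obtain ⟨hrow, hpiv⟩ := den_addRows (s := s₁) hM (by simp [hs₁, hn]) (by simp [hs₁])
  simp only [hs₁, State.setReg_arr, State.setReg_reg, Nat.reduceEqDiff,
    if_false] at hrow
  rw [← hs₁] at hrow
  set s₂ := den n M addRows s₁ with hs₂
  have r₂ : ∀ y, y ∉ addRows.regs → y ≠ 13 → s₂.reg y = s.reg y := fun y hy hy' => by
    rw [hs₂, den_reg _ _ _ hy]; simp [hs₁, hy']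
  have a₂ : ∀ b, b ∉ addRows.arrs → s₂.arr b = s.arr b := fun b hb => by
    rw [hs₂, den_arr _ _ _ hb]; simp [hs₁]
  set c := (s.arr 10 (s.reg 7) + s.arr 10 (s.reg 8) +
    (s.arr 10 (s.reg 9) + s.arr 10 (s.reg 10)) + s.reg 11) % 2 with hc
  have hcM : c % M = c := mod_two_mod hM2 _
  have hden : den n M addEquation s = if s₂.reg 13 = 0 then
      (if c = 0 then s₂.setReg 15 c else (s₂.setReg 15 c).setReg 12 0)
      else den n M substitute (s₂.setReg 15 c) := by
    simp only [addEquation, den_seq, den_assign, den_ite, den_skip, value_zero, Nat.zero_mod, ← hs₁,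
      ← hs₂, value_mod, value_add, value_load, value_reg, value_two, hcM,
      r₂ 7 (by decide) (by decide), r₂ 8 (by decide) (by decide), r₂ 9 (by decide) (by decide),
      r₂ 10 (by decide) (by decide), r₂ 11 (by decide) (by decide), a₂ 10 (by decide), ← hc,
      State.setReg_reg, Nat.reduceEqDiff, if_false, if_true]
  set r : (ℕ → ZMod 2) → ZMod 2 := fun z =>
    ∑ l ∈ Finset.range (n * n), (s₂.arr 11 l : ZMod 2) * z l + c with hr
  have heq : ∀ z, affine (n * n) s z (s.reg 7) + affine (n * n) s z (s.reg 8) +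
      (affine (n * n) s z (s.reg 9) + affine (n * n) s z (s.reg 10)) + s.reg 11 = r z := by
    intro z
    have : ∀ l ∈ Finset.range (n * n), (s₂.arr 11 l : ZMod 2) * z l =
        s.arr 9 (s.reg 7 * (n * n) + l) * z l + s.arr 9 (s.reg 8 * (n * n) + l) * z l +
        (s.arr 9 (s.reg 9 * (n * n) + l) * z l + s.arr 9 (s.reg 10 * (n * n) + l) * z l) :=
      fun l hl => by
        rw [hrow l (Finset.mem_range.1 hl), cast_mod_two]
        push_cast
        ring
    rw [hr]
    simp only [hc, cast_mod_two, Finset.sum_congr rfl this, Finset.sum_add_distrib, affine]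
    push_cast
    ring
  have hcongr : ∀ x y : ℕ → ZMod 2, (∀ j < n * n, x j = y j) → EquationHolds s x →
      EquationHolds s y := fun x y h hx => by
    unfold EquationHolds at hx ⊢
    rwa [← h _ h7, ← h _ h8, ← h _ h9, ← h _ h10]
  rw [hden]
  rcases hpiv with ⟨h13, h11⟩ | ⟨p, hp, h13, h11⟩
  · have hrc : ∀ z, r z = c := fun z => by
      simp only [hr]
      rw [Finset.sum_eq_zero fun l hl => by rw [h11 l (Finset.mem_range.1 hl)]; simp, zero_add]
    rw [if_pos h13]
    have haff : ∀ t : State, t.arr = s₂.arr → affine (n * n) t = affine (n * n) s :=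
      fun t ht => by
        funext z j
        simp [affine, ht, a₂ 9 (by decide), a₂ 10 (by decide)]
    split_ifs with h0
    · refine ⟨fun h z => ?_, fun x hx j hj => ?_, fun h x hx => ?_⟩
      · rw [haff (s₂.setReg 15 c) rfl]
        refine ⟨hs.sound (by simpa [r₂ 12 (by decide)] using h) z, ?_⟩
        rw [EquationHolds, heq, hrc, h0]; simp
      · rw [haff (s₂.setReg 15 c) rfl]
        exact hs.complete x hx.1 j hj
      · exact hs.unsolvable (by simpa [r₂ 12 (by decide)] using h) x hx.1
    -- All coefficients vanish and the constant is `1`: the equation reads `1 = 0`.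
    · have hno : ∀ x, ¬ (E x ∧ EquationHolds s x) := by
        rintro x ⟨hx, hx'⟩
        have h1 : EquationHolds s (affine (n * n) s x) :=
          hcongr x _ (fun j hj => (hs.complete x hx j hj).symm) hx'
        rw [EquationHolds, heq, hrc] at h1
        have : c = 1 := by omega
        rw [this] at h1
        exact absurd h1 (by decide)
      exact ⟨fun h => absurd (by simp) h, fun x hx => absurd hx (hno x), fun _ => hno⟩
  · rw [if_neg (by omega)]
    set s₃ := s₂.setReg 15 c with hs₃
    have hsub := fun j hj => den_substitute (s := s₃) hM2
      (by simp [hs₃, r₂ 0 (by decide), hn]) hp (by simp [hs₃, h13]) (j := j) hj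
    set s₄ := den n M substitute s₃ with hs₄
    have h12 : s₄.reg 12 = s.reg 12 := by
      rw [hs₄, den_reg _ _ _ (by decide)]; simp [hs₃, r₂ 12 (by decide)]
    have haff : ∀ z, ∀ j < n * n, affine (n * n) s₄ z j =
        affine (n * n) s z j + (s.arr 9 (j * (n * n) + p) : ZMod 2) * r z := by
      intro z j hj
      obtain ⟨hA, hB⟩ := hsub j hj
      simp only [hs₃, State.setReg_arr, State.setReg_reg, if_true, a₂ 9 (by decide),
        a₂ 10 (by decide)] at hA hB
      have : ∀ l ∈ Finset.range (n * n), (s₄.arr 9 (j * (n * n) + l) : ZMod 2) * z l =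
          s.arr 9 (j * (n * n) + l) * z l +
            s.arr 9 (j * (n * n) + p) * (s₂.arr 11 l * z l) := fun l hl => by
        rw [hA l (Finset.mem_range.1 hl), cast_mod_two]
        push_cast
        ring
      rw [affine, affine, Finset.sum_congr rfl this, hB, cast_mod_two, Finset.sum_add_distrib,
        ← Finset.mul_sum, hr]
      push_cast
      ring
    have hE' : ∀ x y : ℕ → ZMod 2, (∀ j < n * n, x j = y j) → E x ∧ EquationHolds s x →
        E y ∧ EquationHolds s y := fun x y h hx => ⟨hE x y h hx.1, hcongr x y h hx.2⟩
    refine ⟨fun h z => ?_, fun x hx j hj => ?_, fun h x hx => ?_⟩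
    -- The new map at `z` is the old map at the corrected parameter `z'`, where `r` vanishes.
    · rw [h12] at h
      set z' := Function.update z p (z p + r z) with hz'
      have hzz' : ∀ j < n * n, affine (n * n) s z' j = affine (n * n) s₄ z j := fun j hj => by
        rw [haff z j hj, hz', affine_update hp]
      refine hE' _ _ hzz' ⟨hs.sound h z', ?_⟩
      rw [EquationHolds, heq]
      have h1 : ∀ l ∈ Finset.range (n * n), (s₂.arr 11 l : ZMod 2) * z' l =
          s₂.arr 11 l * z l + if p = l then (s₂.arr 11 l : ZMod 2) * r z else 0 := fun l _ => by
        by_cases h : p = l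
        · subst h; simp [hz', mul_add]
        · simp [hz', h, Function.update_of_ne (Ne.symm h)]
      have h2 : r z' = r z + r z := by
        simp only [hr]
        rw [Finset.sum_congr rfl h1, Finset.sum_add_distrib, Finset.sum_ite_eq,
          if_pos (Finset.mem_range.2 hp), h11]
        simp only [hr, Nat.cast_one, one_mul]
        ring
      rw [h2, CharTwo.add_self_eq_zero]
    · have h1 : EquationHolds s (affine (n * n) s x) :=
        hcongr x _ (fun j hj => (hs.complete x hx.1 j hj).symm) hx.2
      rw [EquationHolds, heq] at h1
      rw [haff x j hj, h1, mul_zero, add_zero]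
      exact hs.complete x hx.1 j hj
    · exact hs.unsolvable (h12 ▸ h) x hx.1

end WordRAM.LoopProg

/-! ## The preparation: adjacency matrix and representatives -/

namespace WordRAM.LoopProg

open Exp
open scoped Classical in
/-- Array `3` contains the adjacency matrix of `G`. -/
def HasAdjMatrix {n : ℕ} (G : SimpleGraph (Fin n)) (s : State) : Prop :=
  ∀ v w : Fin n, s.arr 3 (v * n + w) = if G.Adj v w then 1 else 0

/-- Compute the adjacency matrix. -/
def loadMatrix : LoopProg :=
  loop 2 1 2 (ite (bin .lt (reg 2) (reg 1))
    (store 3 (load 0 (reg 2) * reg 0 + load 1 (reg 2)) 1 ;;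
      store 3 (load 1 (reg 2) * reg 0 + load 0 (reg 2)) 1) skip)

theorem fin_index_inj {n : ℕ} {v w v' w' : Fin n} :
    (v : ℕ) * n + w = v' * n + w' ↔ v = v' ∧ w = w' := by
  rw [mul_add_inj w.isLt w'.isLt, Fin.ext_iff, Fin.ext_iff]

theorem fin_index_lt {n : ℕ} (v w : Fin n) : (v : ℕ) * n + w < n * n := by
  have := Nat.mul_le_mul_right n (Nat.succ_le_of_lt v.isLt)
  have := w.isLt
  rw [Nat.succ_mul] at *
  omega

theorem length_le_of_isEdgeList {n : ℕ} {G : SimpleGraph (Fin n)} {L : List (Fin n × Fin n)}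
    (hL : IsEdgeList G L) : L.length ≤ n * n := by
  have := (List.Nodup.of_map _ hL.1).length_le_card
  simpa using this

/-- Loop bounds may depend only on `n`, so the loop runs through `n * n` indices, which is at least
the length of the list, and ignores those beyond its end. -/
theorem hasAdjMatrix_loadMatrix {n M : ℕ} {G : SimpleGraph (Fin n)} {L : List (Fin n × Fin n)}
    (hL : IsEdgeList G L) (hM : 2 ≤ M) :
    HasAdjMatrix G (den n M loadMatrix (inputState n L)) := by
  classical
  have key := den_loop (n := n) (M := M) (s := inputState n L) loadMatrix (n * n) rfl (by ring)
    (fun i s' => ∀ v w : Fin n, s'.arr 3 (v * n + w) =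
      if s(v, w) ∈ (L.take i).map fun p => s(p.1, p.2) then 1 else 0) ?_ ?_
  · rw [List.take_of_length_le (length_le_of_isEdgeList hL)] at key
    intro v w
    rw [key v w]
    exact if_congr ((hL.2 _).trans G.mem_edgeSet) rfl rfl
  · simp [inputState]
  · intro i hi s' h h2 hr ha v w
    have h1 : s'.reg 1 = L.length := by rw [hr 1 (by decide)]; simp [inputState]
    have h0 : s'.reg 0 = n := by rw [hr 0 (by decide)]; simp [inputState]
    have a0 : s'.arr 0 i = (L[i]?).elim 0 (fun p => p.1.val) := by
      rw [ha 0 (by decide)]; simp [inputState]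
    have a1 : s'.arr 1 i = (L[i]?).elim 0 (fun p => p.2.val) := by
      rw [ha 1 (by decide)]; simp [inputState]
    have h1M : 1 % M = 1 := Nat.mod_eq_of_lt (by omega)
    by_cases hiL : i < L.length
    · rw [List.getElem?_eq_getElem hiL, Option.elim_some] at a0 a1
      have ht : (L.take (i + 1)).map (fun p => s(p.1, p.2)) =
          (L.take i).map (fun p => s(p.1, p.2)) ++ [s(L[i].1, L[i].2)] := by
        rw [← List.take_concat_get' _ _ hiL, List.map_append]; rfl
      simp only [den_ite, value_lt, value_reg, h2, h1, hiL, if_true, one_ne_zero, if_false, den_seq,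
        den_store, value_add, value_mul, value_load, value_one, h1M, State.setArr_reg, h0, a0,
        a1, State.setReg_arr, State.setArr_arr, fin_index_inj, true_and, h v w, ht,
        List.mem_append, List.mem_singleton, Sym2.eq_iff, OfNat.one_ne_ofNat, OfNat.zero_ne_ofNat,
        false_and]
      by_cases c1 : v = L[i].1 ∧ w = L[i].2 <;> by_cases c2 : v = L[i].2 ∧ w = L[i].1 <;>
        simp [c1, c2]
    · have ht : L.take (i + 1) = L.take i := by
        rw [List.take_of_length_le (by omega), List.take_of_length_le (by omega)]
      simpa [h2, h1, hiL, ht] using h v w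

/-- Count the common neighbors of `reg 3` and `reg 2`. -/
def countCommon : LoopProg :=
  loop 4 1 1 (assign 6 (reg 6 +
    load 3 (reg 3 * reg 0 + reg 4) * load 3 (reg 2 * reg 0 + reg 4)))

/-- Find the representative of `reg 2`. -/
def findRep (k : ℕ) : LoopProg :=
  loop 3 1 1 (assign 6 0 ;; countCommon ;;
    ite (bin .lt (const (2 * k)) (reg 6) * bin .lt (reg 3) (reg 5)) (assign 5 (reg 3)) skip)

/-- Compute all representatives in array `4`, and mark them in array `5`. -/
def findReps (k : ℕ) : LoopProg :=
  loop 2 1 1 (assign 5 (reg 2) ;; findRep k ;; store 4 (reg 2) (reg 5) ;; store 5 (reg 5) 1)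

open scoped Classical in
theorem den_countCommon {n M : ℕ} {G : SimpleGraph (Fin n)} {s : State} (hM : n < M)
    (hn : s.reg 0 = n) (hG : HasAdjMatrix G s) {v w : Fin n} (h3 : s.reg 3 = w)
    (h2 : s.reg 2 = v) (h6 : s.reg 6 = 0) :
    (den n M countCommon s).reg 6 = commonCount G w v := by
  have h01 : ∀ v w : Fin n, s.arr 3 (v * n + w) ≤ 1 := fun v w => by
    rw [hG]; split_ifs <;> omega
  have key := den_loop (n := n) (M := M) (s := s) countCommon n rfl (by ring)
    (fun i s' => i ≤ n → s'.reg 6 ≤ i ∧ s'.reg 6 = ∑ u ∈ Finset.range i,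
      s.arr 3 (w * n + u) * s.arr 3 (v * n + u)) ?_ ?_
  · rw [(key le_rfl).2, Finset.sum_range, commonCount, Finset.card_filter]
    refine Finset.sum_congr rfl fun u _ => ?_
    rw [hG, hG]
    split_ifs <;> simp_all
  · simp [h6]
  · intro i hi s' h h4 hr ha hi'
    obtain ⟨h1, h1'⟩ := h (by omega)
    have hle := Nat.mul_le_mul (h01 w ⟨i, hi⟩) (h01 v ⟨i, hi⟩)
    simp only at hle
    simp only [den_assign, value_add, value_mul, value_load, value_reg, h4, hr 3 (by decide),
      hr 2 (by decide), hr 0 (by decide), ha 3 (by decide), hn, h3, h2, State.setReg_reg,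
      Nat.reduceEqDiff, if_true, if_false, Finset.sum_range_succ, ← h1']
    rw [Nat.mod_eq_of_lt (by omega)]
    omega

open scoped Classical in
theorem den_findRep {n M k : ℕ} {G : SimpleGraph (Fin n)} {s : State} (hM : n < M)
    (hn : s.reg 0 = n) (hG : HasAdjMatrix G s) {v : Fin n} (h2 : s.reg 2 = v) (h5 : s.reg 5 = v)
    {rep : Fin n → Fin n} (hrep : IsRep k G rep) : (den n M (findRep k) s).reg 5 = rep v := by
  have key := den_loop (n := n) (M := M) (s := s) (findRep k) n rfl (by ring)
    (fun i s' => IsLeast {y : ℕ | ∃ w : Fin n, y = w ∧ (w = v ∨ w.val < i ∧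
      2 * k < commonCount G w v)} (s'.reg 5)) ?_ ?_
  · refine key.unique ⟨⟨rep v, rfl, ?_⟩, ?_⟩
    · exact (hrep v).1.imp id fun h => ⟨(rep v).isLt, h⟩
    · rintro _ ⟨w, rfl, hw⟩
      exact (hrep v).2 (hw.imp id And.right)
  · simp [h5]
  · intro i hi s' h h3 hr ha
    have h0' : s'.reg 0 = n := by rw [hr 0 (by simp [findRep, regs, countCommon]), hn]
    have h2' : s'.reg 2 = v := by rw [hr 2 (by simp [findRep, regs, countCommon]), h2]
    have hG' : HasAdjMatrix G (s'.setReg 6 0) := by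
      have := ha 3 (by simp [findRep, arrs, countCommon])
      simpa [HasAdjMatrix, this] using hG
    have hc := den_countCommon (s := s'.setReg 6 0) hM (by simp [h0']) hG'
      (v := v) (w := ⟨i, hi⟩) (by simp [h3]) (by simp [h2']) (by simp)
    have h3' : (den n M countCommon (s'.setReg 6 0)).reg 3 = i := by
      rw [den_reg _ _ _ (by decide)]; simp [h3]
    have h5' : (den n M countCommon (s'.setReg 6 0)).reg 5 = s'.reg 5 := by
      rw [den_reg _ _ _ (by decide)]; simp
    have hiM : i % M = i := Nat.mod_eq_of_lt (by omega)
    simp only [den_seq, den_assign, den_ite, den_skip, value_zero, Nat.zero_mod, value_mul, value_lt, value_const,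
      value_reg, hc, h3', h5', hiM]
    by_cases hcc : 2 * k < commonCount G ⟨i, hi⟩ v
    · have hset : {y : ℕ | ∃ w : Fin n, y = w ∧ (w = v ∨ w.val < i + 1 ∧
          2 * k < commonCount G w v)} = insert i {y : ℕ | ∃ w : Fin n, y = w ∧
          (w = v ∨ w.val < i ∧ 2 * k < commonCount G w v)} := by
        ext y
        simp only [Set.mem_ofPred_eq, Set.mem_insert_iff]
        constructor
        · rintro ⟨w, rfl, hw | ⟨hw, hw'⟩⟩
          · exact .inr ⟨w, rfl, .inl hw⟩
          · rcases Nat.lt_succ_iff_lt_or_eq.1 hw with hw | hw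
            · exact .inr ⟨w, rfl, .inr ⟨hw, hw'⟩⟩
            · exact .inl hw
        · rintro (rfl | ⟨w, rfl, hw⟩)
          · exact ⟨⟨y, hi⟩, rfl, .inr ⟨by simp, hcc⟩⟩
          · exact ⟨w, rfl, hw.imp id fun h => ⟨by omega, h.2⟩⟩
      rw [hset]
      have := h.insert i
      by_cases hlt : i < s'.reg 5
      · rw [min_eq_left hlt.le] at this
        simpa [hcc, hlt] using this
      · rw [min_eq_right (by omega)] at this
        simpa [hcc, hlt, h5'] using this
    · have hset : {y : ℕ | ∃ w : Fin n, y = w ∧ (w = v ∨ w.val < i + 1 ∧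
          2 * k < commonCount G w v)} = {y : ℕ | ∃ w : Fin n, y = w ∧
          (w = v ∨ w.val < i ∧ 2 * k < commonCount G w v)} := by
        ext y
        simp only [Set.mem_ofPred_eq]
        refine exists_congr fun w => and_congr_right fun _ => or_congr_right <|
          and_congr_left fun hw => ?_
        rw [Nat.lt_succ_iff_lt_or_eq]
        refine or_iff_left fun hwi => hcc ?_
        rwa [show (⟨i, hi⟩ : Fin n) = w from Fin.ext hwi.symm]
      rw [hset]
      simpa [hcc, h5'] using h

open scoped Classical in
theorem exists_isRep {n : ℕ} (k : ℕ) (G : SimpleGraph (Fin n)) :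
    ∃ rep : Fin n → Fin n, IsRep k G rep := by
  have : ∀ v, ∃ r, IsLeast {w | w = v ∨ 2 * k < commonCount G w v} r := fun v =>
    (Set.toFinite {w | w = v ∨ 2 * k < commonCount G w v}).exists_minimal (⟨v, .inl rfl⟩) |>.imp
      fun r hr => ⟨hr.1, fun w hw => (le_total r w).elim id fun h => hr.2 hw h⟩
  choose rep hrep using this
  exact ⟨rep, hrep⟩

open scoped Classical in
/-- The adjacency matrix and the representatives have been computed. -/
structure Prepared {n : ℕ} (G : SimpleGraph (Fin n)) (rep : Fin n → Fin n) (s : State) : Prop where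
  size : s.reg 0 = n
  adj : HasAdjMatrix G s
  reps : ∀ v : Fin n, s.arr 4 v = rep v
  mark : ∀ u < n, s.arr 5 u = if ∃ v, (rep v : ℕ) = u then 1 else 0

open scoped Classical in
theorem prepared_findReps {n M k : ℕ} {G : SimpleGraph (Fin n)} {s : State} (hM : n < M)
    (hM2 : 2 ≤ M) (hn : s.reg 0 = n) (hG : HasAdjMatrix G s) (h5 : s.arr 5 = fun _ => 0)
    {rep : Fin n → Fin n} (hrep : IsRep k G rep) : Prepared G rep (den n M (findReps k) s) := by
  have hregs : 0 ∉ (findReps k).regs := by simp [findReps, findRep, regs, countCommon]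
  have harrs : 3 ∉ (findReps k).arrs := by simp [findReps, findRep, arrs, countCommon]
  have key := den_loop (n := n) (M := M) (s := s) (findReps k) n rfl (by ring)
    (fun i s' => (∀ v : Fin n, v.val < i → s'.arr 4 v = rep v) ∧
      ∀ u < n, s'.arr 5 u = if ∃ v : Fin n, v.val < i ∧ (rep v : ℕ) = u then 1 else 0) ?_ ?_
  · refine ⟨by rw [den_reg _ _ _ hregs, hn], ?_, fun v => key.1 v v.isLt, fun u hu => ?_⟩
    · have := den_arr n M _ harrs s
      simpa [HasAdjMatrix, this] using hG
    · rw [key.2 u hu]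
      simp
  · simp [h5]
  · rintro i hi s' ⟨h4, h5⟩ h2 hr ha
    have hG' : HasAdjMatrix G (s'.setReg 5 (i % M)) := by
      have := ha 3 harrs
      simpa [HasAdjMatrix, this] using hG
    have hiM : i % M = i := Nat.mod_eq_of_lt (by omega)
    have h1M : 1 % M = 1 := Nat.mod_eq_of_lt (by omega)
    have hf := den_findRep (s := s'.setReg 5 (i % M)) hM (by simp [hr 0 hregs, hn]) hG'
      (v := ⟨i, hi⟩) (by simp [h2]) (by simp [hiM]) hrep
    have h2' : (den n M (findRep k) (s'.setReg 5 (i % M))).reg 2 = i := by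
      rw [den_reg _ _ _ (by simp [findRep, regs, countCommon])]; simp [h2]
    have ha4 : (den n M (findRep k) (s'.setReg 5 (i % M))).arr = s'.arr := by
      funext b
      rw [den_arr _ _ _ (by simp [findRep, arrs, countCommon])]; simp
    have hrM : (rep ⟨i, hi⟩ : ℕ) % M = rep ⟨i, hi⟩ := Nat.mod_eq_of_lt (by omega)
    simp only [den_seq, den_assign, den_store, value_reg, value_one, h2, h2', hf, hrM, h1M, ha4,
      State.setReg_arr, State.setArr_arr, State.setArr_reg]
    constructor
    · intro v hv
      rcases Nat.lt_succ_iff_lt_or_eq.1 hv with hv | hv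
      · simp [h4 v hv, hv.ne]
      · obtain rfl : v = ⟨i, hi⟩ := Fin.ext hv
        simp
    · intro u hu
      have : (∃ v : Fin n, v.val < i + 1 ∧ (rep v : ℕ) = u) ↔
          (u = rep ⟨i, hi⟩ ∨ ∃ v : Fin n, v.val < i ∧ (rep v : ℕ) = u) := by
        constructor
        · rintro ⟨v, hv, hvu⟩
          rcases Nat.lt_succ_iff_lt_or_eq.1 hv with hv | hv
          · exact .inr ⟨v, hv, hvu⟩
          · obtain rfl : v = ⟨i, hi⟩ := Fin.ext hv
            exact .inl hvu.symm
        · rintro (h | ⟨v, hv, hvu⟩)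
          · exact ⟨⟨i, hi⟩, by simp, h.symm⟩
          · exact ⟨v, by omega, hvu⟩
      rw [if_congr this rfl rfl]
      by_cases hu' : u = rep ⟨i, hi⟩
      · simp [hu']
      · simp [hu', h5 u hu]

end WordRAM.LoopProg

/-! ## Testing one coloring of the representatives -/

theorem exists_digits {k : ℕ} (R : ℕ) (f : ℕ → ℕ) (hf : ∀ i, f i < k) :
    ∃ c < k ^ R, ∀ i < R, c / k ^ i % k = f i := by
  induction R generalizing f with
  | zero => exact ⟨0, by simp⟩
  | succ R ih =>
    obtain ⟨c, hc, h⟩ := ih (fun i => f (i + 1)) fun i => hf _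
    have hk : 0 < k := (Nat.zero_le _).trans_lt (hf 0)
    refine ⟨f 0 + k * c, ?_, fun i hi => ?_⟩
    · have := Nat.mul_le_mul_left k (Nat.succ_le_of_lt hc)
      have := hf 0
      rw [pow_succ']
      rw [Nat.mul_succ] at *
      omega
    · cases i with
      | zero => simp [Nat.mod_eq_of_lt (hf 0)]
      | succ i =>
        rw [pow_succ', ← Nat.div_div_eq_div_mul, Nat.add_mul_div_left _ _ hk,
          Nat.div_eq_of_lt (hf 0), zero_add]
        exact h i (by omega)

namespace WordRAM.LoopProg

open Exp

section Coloring

variable {n : ℕ}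

open scoped Classical in
/-- The number of representatives smaller than `u`. -/
def rank (rep : Fin n → Fin n) (u : ℕ) : ℕ :=
  Nat.count (fun u => ∃ v, (rep v : ℕ) = u) u

/-- The coloring with code `c`: the digits of `c` in base `k` are the colors of the
representatives. -/
def decode (k : ℕ) (rep : Fin n → Fin n) (c : ℕ) (v : Fin n) : ℕ :=
  c / k ^ rank rep (rep v) % k

/-- The digit with index `i` is the color of the `i`-th smallest representative, which `Nat.nth`
recovers from its `rank`. Ranks stay below the number of representatives, so `R` digits are enough.
-/
theorem exists_decode {k R : ℕ} {rep : Fin n → Fin n} (hR : (Finset.univ.image rep).card ≤ R)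
    {col : Fin n → ℕ} (hk : ∀ v, col v < k) (hk0 : 0 < k) (hrep : ∀ v, col (rep v) = col v) :
    ∃ c < k ^ R, decode k rep c = col := by
  classical
  set P : ℕ → Prop := fun u => ∃ v, (rep v : ℕ) = u with hP
  -- Digits without a representative get the default `0`, a legal digit because `0 < k`.
  set f : ℕ → ℕ := fun i => if h : Nat.nth P i < n then col ⟨Nat.nth P i, h⟩ else 0 with hf
  obtain ⟨c, hc, h⟩ := exists_digits R f fun i => by
    simp only [hf]
    split_ifs
    exacts [hk _, hk0]
  refine ⟨c, hc, funext fun v => ?_⟩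
  have hPv : P (rep v) := ⟨v, rfl⟩
  have hlt : rank rep (rep v) < R := by
    have h1 : Nat.count P (rep v) < Nat.count P (rep v + 1) := by
      rw [Nat.count_succ, if_pos hPv]; omega
    have h2 : Nat.count P (rep v + 1) ≤ Nat.count P n := Nat.count_monotone P (rep v).isLt
    have h3 : Nat.count P n ≤ (Finset.univ.image rep).card := by
      rw [Nat.count_eq_card_filter_range, ← Finset.card_image_of_injective _ Fin.val_injective]
      refine Finset.card_le_card fun u hu => ?_
      obtain ⟨-, w, rfl⟩ := Finset.mem_filter.1 hu
      exact Finset.mem_image_of_mem _ (Finset.mem_image_of_mem _ (Finset.mem_univ _))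
    have h4 : rank rep (rep v) = Nat.count P (rep v) := by
      unfold rank; congr
    omega
  have hnth : Nat.nth P (rank rep (rep v)) = rep v := by
    unfold rank; exact Nat.nth_count hPv
  rw [decode, h _ hlt]
  simp only [hf, hnth, Fin.is_lt, dite_true, Fin.eta, hrep]

/-- Compute in array `7` the coloring with the code in register `2`. -/
def colorLoop (k : ℕ) : LoopProg :=
  loop 4 1 1
    (ite (load 5 (reg 4)) (store 6 (reg 4) (reg 3 % const k) ;; assign 3 (reg 3 / const k)) skip ;;
    store 7 (reg 4) (load 6 (load 4 (reg 4))))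

-- The digits are handed out to the representatives in increasing order. Since `rep v ≤ v`, the
-- color of `rep v` is already stored when `v` asks for it, and one pass suffices.
open scoped Classical in
theorem den_colorLoop {M k : ℕ} {G : SimpleGraph (Fin n)} {rep : Fin n → Fin n} {s : State}
    (hk : 0 < k) (hM : k ≤ M) (h3 : s.reg 3 < M) (hs : Prepared G rep s)
    (hrep : ∀ v, rep v ≤ v) (v : Fin n) :
    (den n M (colorLoop k) s).arr 7 v = decode k rep (s.reg 3) v := by
  set c := s.reg 3 with hc
  set P : ℕ → Prop := fun u => ∃ v, (rep v : ℕ) = u with hP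
  have key := den_loop (n := n) (M := M) (s := s) (colorLoop k) n rfl (by ring)
    (fun i s' => s'.reg 3 = c / k ^ rank rep i ∧
      (∀ u < i, P u → s'.arr 6 u = c / k ^ rank rep u % k) ∧
      ∀ v : Fin n, v.val < i → s'.arr 7 v = decode k rep c v) ?_ ?_
  · exact key.2.2 v v.isLt
  · simp [rank, hc]
  · rintro i hi s' ⟨h1, h2, h3'⟩ h4 hr ha
    have a4 := ha 4 (by simp [colorLoop, arrs])
    have a5 := ha 5 (by simp [colorLoop, arrs])
    have hmod : ∀ a, a % k % M = a % k := fun a =>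
      Nat.mod_eq_of_lt ((Nat.mod_lt _ hk).trans_le hM)
    have hdivM : ∀ a, c / a % M = c / a := fun a =>
      Nat.mod_eq_of_lt ((Nat.div_le_self _ _).trans_lt h3)
    have h5i := hs.mark i hi
    have h4i : s.arr 4 i = rep ⟨i, hi⟩ := hs.reps ⟨i, hi⟩
    have hri : (rep ⟨i, hi⟩ : ℕ) ≤ i := hrep ⟨i, hi⟩
    have hPr : P (rep ⟨i, hi⟩) := ⟨_, rfl⟩
    have hrank : rank rep (i + 1) = rank rep i + if P i then 1 else 0 := by
      unfold rank; rw [Nat.count_succ]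
    set t := den n M (ite (load 5 (reg 4))
      (store 6 (reg 4) (reg 3 % const k) ;; assign 3 (reg 3 / const k)) skip) s' with ht
    have ht3 : t.reg 3 = c / k ^ rank rep (i + 1) := by
      by_cases hPi : P i
      · rw [ht, hrank, if_pos hPi]
        rw [if_pos hPi] at h5i
        simp [h4, a5, h5i, h1, Nat.div_div_eq_div_mul, ← pow_succ, hdivM]
      · rw [ht, hrank, if_neg hPi]
        rw [if_neg hPi] at h5i
        simp [h4, a5, h5i, h1]
    have ht6 : ∀ u < i + 1, P u → t.arr 6 u = c / k ^ rank rep u % k := by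
      intro u hu hPu
      rcases Nat.lt_succ_iff_lt_or_eq.1 hu with hu | rfl
      · by_cases hPi : P i
        · rw [if_pos hPi] at h5i
          simp [ht, h4, a5, h5i, hu.ne, h2 u hu hPu]
        · rw [if_neg hPi] at h5i
          simp [ht, h4, a5, h5i, h2 u hu hPu]
      · rw [if_pos hPu] at h5i
        simp [ht, h4, a5, h5i, h1, hmod]
    have ht7 : t.arr 7 = s'.arr 7 := by
      rw [ht, den_arr _ _ _ (by simp [arrs])]
    have ht4 : t.arr 4 = s.arr 4 := by
      rw [ht, den_arr _ _ _ (by simp [arrs]), a4]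
    have htr4 : t.reg 4 = i := by
      rw [ht, den_reg _ _ _ (by simp [regs]), h4]
    rw [den_seq, ← ht]
    simp only [den_store, value_reg, value_load, htr4, ht4, h4i, State.setReg_reg,
      State.setReg_arr, State.setArr_reg, State.setArr_arr]
    refine ⟨by simpa using ht3, fun u hu hPu => by simpa using ht6 u hu hPu, fun v hv => ?_⟩
    rcases Nat.lt_succ_iff_lt_or_eq.1 hv with hv | hv
    · simp [hv.ne, ht7, h3' v hv]
    · obtain rfl : v = ⟨i, hi⟩ := Fin.ext hv
      simp [ht6 _ (Nat.lt_succ_of_le hri) hPr, hmod, decode]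

/-- Compute in array `8` the matrix of the edges between vertices of different colors. Register `12`
becomes `0` if some color class is not a clique. -/
def crossLoop : LoopProg :=
  loop 3 1 2
    (ite (bin .eq (load 7 (reg 3 / reg 0)) (load 7 (reg 3 % reg 0)))
      (store 8 (reg 3) 0 ;;
        ite (load 3 (reg 3) + bin .eq (reg 3 / reg 0) (reg 3 % reg 0)) skip (assign 12 0))
      (store 8 (reg 3) (load 3 (reg 3))))

open scoped Classical in
/-- Array `8` contains the matrix of the edges between vertices of different colors. -/
def HasCrossMatrix (G : SimpleGraph (Fin n)) (col : Fin n → ℕ) (s : State) : Prop :=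
  ∀ v w : Fin n, s.arr 8 (v * n + w) = if (crossGraph G col).Adj v w then 1 else 0

theorem exists_fin_index {i : ℕ} (hi : i < n * n) : ∃ v w : Fin n, (v : ℕ) * n + w = i ∧
    i / n = v ∧ i % n = w := by
  have hn : 0 < n := Nat.pos_of_ne_zero fun h => by simp [h] at hi
  exact ⟨⟨i / n, Nat.div_lt_of_lt_mul hi⟩, ⟨i % n, Nat.mod_lt _ hn⟩, Nat.div_add_mod' i n, rfl, rfl⟩

theorem den_crossLoop {M : ℕ} {G : SimpleGraph (Fin n)} {col : Fin n → ℕ} {s : State}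
    (hM : 2 ≤ M) (hn : s.reg 0 = n) (hG : HasAdjMatrix G s) (hcol : ∀ v : Fin n, s.arr 7 v = col v)
    (h12 : s.reg 12 = 1) : HasCrossMatrix G col (den n M crossLoop s) ∧
      ((den n M crossLoop s).reg 12 ≠ 0 ↔ IsCliqueColoring G col) := by
  classical
  have key := den_loop (n := n) (M := M) (s := s) crossLoop (n * n) rfl (by ring)
    (fun i s' => (∀ v w : Fin n, (v : ℕ) * n + w < i →
      s'.arr 8 (v * n + w) = if (crossGraph G col).Adj v w then 1 else 0) ∧
      (s'.reg 12 ≠ 0 ↔ ∀ v w : Fin n, (v : ℕ) * n + w < i → v ≠ w → col v = col w → G.Adj v w))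
    ?_ ?_
  · refine ⟨fun v w => key.1 v w (fin_index_lt v w), key.2.trans ?_⟩
    exact forall₂_congr fun v w => ⟨fun h => h (fin_index_lt v w), fun h _ => h⟩
  · simp [h12]
  · rintro i hi s' ⟨h1, h2⟩ h3 hr ha
    obtain ⟨v, w, rfl, hv, hw⟩ := exists_fin_index hi
    have h0 : s'.reg 0 = n := by rw [hr 0 (by decide), hn]
    have h1M : 1 % M = 1 := Nat.mod_eq_of_lt (by omega)
    have hsplit : ∀ v' w' : Fin n, (v' : ℕ) * n + w' < v * n + w + 1 →
        (v' : ℕ) * n + w' < v * n + w ∨ v' = v ∧ w' = w := fun v' w' h => by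
      rw [← fin_index_inj]; omega
    have hGvw := hG v w
    simp only [den_ite, den_seq, den_skip, den_store, den_assign, value_eq, value_load, value_div,
      value_mod, value_reg, value_add, value_zero, Nat.zero_mod, h3, h0, hv, hw,
      ha 7 (by decide), ha 3 (by decide), hcol, State.setArr_reg, State.setArr_arr,
      Nat.reduceEqDiff, false_and, if_false, hGvw]
    by_cases hc : col v = col w
    · have hB : ¬ (crossGraph G col).Adj v w := fun h => h.2 hc
      have key1 : ∀ v' w' : Fin n, (v' : ℕ) * n + w' < v * n + w + 1 →
          (s'.setArr 8 (v * n + w) 0).arr 8 (v' * n + w') =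
            if (crossGraph G col).Adj v' w' then 1 else 0 := by
        intro v' w' h
        rcases hsplit v' w' h with h | ⟨rfl, rfl⟩
        · simp [h.ne, h1 v' w' h]
        · simp [hB]
      by_cases hok : v ≠ w → G.Adj v w
      · have : (if G.Adj v w then 1 else 0) + (if (v : ℕ) = w then 1 else 0) ≠ 0 := by
          by_cases h : v = w
          · simp [h]
          · simp [hok h]
        simp only [hc, if_true, one_ne_zero, if_false, this]
        refine ⟨key1, h2.trans ⟨fun h v' w' h' => ?_, fun h v' w' h' => h v' w' (by omega)⟩⟩
        rcases hsplit v' w' h' with h' | ⟨rfl, rfl⟩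
        · exact h v' w' h'
        · exact fun hne _ => hok hne
      · have : (if G.Adj v w then 1 else 0) + (if (v : ℕ) = w then 1 else 0) = 0 := by
          rw [Classical.not_imp] at hok
          simp [hok.2, Fin.val_ne_iff.2 hok.1]
        simp only [hc, if_true, one_ne_zero, if_false, this]
        refine ⟨key1, ⟨fun h => by simp at h, fun h => ?_⟩⟩
        exact absurd (fun hne => h v w (by omega) hne hc) hok
    · have hB : (crossGraph G col).Adj v w ↔ G.Adj v w := ⟨fun h => h.1, fun h => ⟨h, hc⟩⟩
      have hmM : (if G.Adj v w then 1 else 0) % M = if G.Adj v w then 1 else 0 := by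
        split_ifs <;> simp [h1M]
      simp only [hc, if_false, if_true, hmM]
      refine ⟨fun v' w' h' => ?_, ?_⟩
      · rcases hsplit v' w' h' with h' | ⟨rfl, rfl⟩
        · simp [h'.ne, h1 v' w' h']
        · simp [hB]
      · refine Iff.trans (by simp) (h2.trans ⟨fun h v' w' h' => ?_,
          fun h v' w' h' => h v' w' (by omega)⟩)
        rcases hsplit v' w' h' with h' | ⟨rfl, rfl⟩
        · exact h v' w' h'
        · exact fun _ h => absurd h hc

/-- Initialize the system of linear equations. -/
def initSystem : LoopProg :=
  loop 3 1 2 (store 10 (reg 3) 0 ;;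
    loop 4 1 2 (store 9 (reg 3 * (reg 0 * reg 0) + reg 4) (bin .eq (reg 3) (reg 4))))

/-- The parametrization starts as the identity, which describes the solutions of the empty system.
-/
theorem den_initSystem {M : ℕ} {s : State} (hM : 2 ≤ M) (hn : s.reg 0 = n) (z : ℕ → ZMod 2) {j : ℕ}
    (hj : j < n * n) : affine (n * n) (den n M initSystem s) z j = z j := by
  have h1M : 1 % M = 1 := Nat.mod_eq_of_lt (by omega)
  have inner : ∀ s : State, s.reg 0 = n → ∀ j, ∀ l < n * n,
      (den n M (loop 4 1 2 (store 9 (reg 3 * (reg 0 * reg 0) + reg 4)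
        (bin .eq (reg 3) (reg 4)))) s).arr 9 (j * (n * n) + l) =
      if j = s.reg 3 then (if j = l then 1 else 0) else s.arr 9 (j * (n * n) + l) := by
    intro s hn j l hl
    have key := den_loop (n := n) (M := M) (s := s)
      (loop 4 1 2 (store 9 (reg 3 * (reg 0 * reg 0) + reg 4) (bin .eq (reg 3) (reg 4)))) (n * n)
      rfl (by ring) (fun i s' => ∀ j, ∀ l < n * n, s'.arr 9 (j * (n * n) + l) =
        if j = s.reg 3 ∧ l < i then (if j = l then 1 else 0) else s.arr 9 (j * (n * n) + l)) ?_ ?_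
    · simpa [hl] using key j l hl
    · simp
    · intro i hi s' h h4 hr ha j l hl
      simp only [den_store, value_add, value_mul, value_reg, value_eq, h4, hr 3 (by decide),
        hr 0 (by decide), hn, State.setReg_arr, State.setArr_arr, mul_add_inj hl hi, true_and,
        h j l hl]
      by_cases hj : j = s.reg 3
      · subst hj
        rcases lt_trichotomy l i with h | rfl | h
        · simp [h, h.ne, h.trans (Nat.lt_succ_self i)]
        · split_ifs <;> simp_all
        · simp [h.ne', show ¬ l < i by omega, show ¬ l < i + 1 by omega]
      · simp [hj]
  have key := den_loop (n := n) (M := M) (s := s) initSystem (n * n) rfl (by ring)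
    (fun i s' => ∀ j < n * n, j < i → s'.arr 10 j = 0 ∧ ∀ l < n * n, s'.arr 9 (j * (n * n) + l) =
      if j = l then 1 else 0) ?_ ?_
  · obtain ⟨h1, h2⟩ := key j hj hj
    have : ∀ l ∈ Finset.range (n * n),
        ((den n M initSystem s).arr 9 (j * (n * n) + l) : ZMod 2) * z l =
          if j = l then z l else 0 := fun l hl => by
      rw [h2 l (Finset.mem_range.1 hl)]
      split_ifs <;> simp
    rw [affine, Finset.sum_congr rfl this, h1, Finset.sum_ite_eq, if_pos (Finset.mem_range.2 hj)]
    simp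
  · simp
  · intro i hi s' h h3 hr ha j hj hji
    have h0 : s'.reg 0 = n := by rw [hr 0 (by decide), hn]
    simp only [den_seq, State.setReg_arr]
    rw [den_arr (b := 10) _ _ _ (by decide)]
    constructor
    · rcases Nat.lt_succ_iff_lt_or_eq.1 hji with hji | rfl
      · simp [h3, hji.ne, (h j hj hji).1]
      · simp [h3]
    · intro l hl
      rw [inner _ (by simp [h0]) j l hl]
      rcases Nat.lt_succ_iff_lt_or_eq.1 hji with hji | rfl
      · simp [h3, hji.ne, (h j hj hji).2 l hl]
      · simp [h3]

/-- Collect the linear equations. For `k = 1` there are none. -/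
def equationLoop (k : ℕ) : LoopProg :=
  loop 3 (min (k - 1) 1) 3
    (assign 4 (reg 3 / (reg 0 * reg 0)) ;;
    assign 5 (reg 3 / reg 0 % reg 0) ;;
    assign 6 (reg 3 % reg 0) ;;
    ite (load 8 (reg 4 * reg 0 + reg 5) * load 8 (reg 4 * reg 0 + reg 6) *
        (1 - bin .eq (reg 5) (reg 6)))
      (assign 7 (reg 4 * reg 0 + reg 5) ;;
        assign 8 (reg 4 * reg 0 + reg 6) ;;
        assign 9 (load 8 (reg 5 * reg 0 + reg 6) * (reg 5 * reg 0 + reg 4)) ;;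
        assign 10 (load 8 (reg 5 * reg 0 + reg 6) * (reg 5 * reg 0 + reg 6)) ;;
        assign 11 (1 - load 8 (reg 5 * reg 0 + reg 6)) ;;
        addEquation)
      skip)

end Coloring

end WordRAM.LoopProg

/-! ### Solving the line graph equations and reading off the root graph. -/

namespace WordRAM.LoopProg

open Exp

theorem Solves.congr {N : ℕ} {E E' : (ℕ → ZMod 2) → Prop} {s s' : State} (hs : Solves N E s)
    (hE : ∀ x, E x ↔ E' x) (h9 : s'.arr 9 = s.arr 9) (h10 : s'.arr 10 = s.arr 10)
    (h12 : s'.reg 12 = s.reg 12) : Solves N E' s' := by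
  have haff : affine N s' = affine N s := by
    funext z j
    simp [affine, h9, h10]
  refine ⟨fun h z => ?_, fun x hx j hj => ?_, fun h x hx => ?_⟩
  · rw [haff, ← hE]
    exact hs.sound (h12 ▸ h) z
  · rw [haff]
    exact hs.complete x ((hE x).2 hx) j hj
  · exact hs.unsolvable (h12 ▸ h) x ((hE x).2 hx)

/-- The linear equation for the adjacent pairs `v w` and `v u`. -/
def EndEquation {V : Type*} (B : SimpleGraph V) (x : V → V → ZMod 2) (v w u : V) : Prop :=
  B.Adj v w → B.Adj v u → w ≠ u →
    (B.Adj w u → x v w + x v u + x w v + x w u = 0) ∧ (¬ B.Adj w u → x v w + x v u + 1 = 0)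

theorem fin_index₃_lt {n : ℕ} (v w u : Fin n) : ((v : ℕ) * n + w) * n + u < n ^ 3 := by
  have := Nat.mul_le_mul_right n (Nat.succ_le_of_lt (fin_index_lt v w))
  have := u.isLt
  rw [Nat.succ_mul] at *
  rw [pow_succ, sq]
  omega

/-- The proposition `Q` carries the result of the clique test, which shares the flag in register
`12` with the solver. -/
theorem solves_equationLoop {n M k : ℕ} {G : SimpleGraph (Fin n)} {col : Fin n → ℕ} {s : State}
    {Q : Prop} (hM : n * n + 2 ≤ M) (hk : ∀ v, col v < k) (hn : s.reg 0 = n)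
    (hB : HasCrossMatrix G col s) (hs : Solves (n * n) (fun _ => Q) s) :
    Solves (n * n) (fun x => Q ∧ IsEndSystem (crossGraph G col) fun v w => x (v * n + w))
      (den n M (equationLoop k) s) := by
  classical
  have key := den_loop (n := n) (M := M) (s := s) (equationLoop k) (min (k - 1) 1 * n ^ 3) rfl rfl
    (fun i s' => Solves (n * n) (fun x => Q ∧ ∀ v w u : Fin n, ((v : ℕ) * n + w) * n + u < i →
      EndEquation (crossGraph G col) (fun v w => x (v * n + w)) v w u) s') ?_ ?_
  · refine key.congr (fun x => and_congr_right fun _ => ?_) rfl rfl rfl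
    refine forall_congr' fun v => forall₂_congr fun w u => ?_
    rcases Nat.lt_or_ge 1 k with h1 | h1
    · rw [min_eq_right (by omega), one_mul]
      exact ⟨fun h => h (fin_index₃_lt v w u), fun h _ => h⟩
    -- With at most one color there are no cross edges, so the omitted equations are vacuous.
    · have hno : ∀ v w, ¬ (crossGraph G col).Adj v w := fun v w h => by
        have := hk v
        have := hk w
        exact h.2 (by omega)
      exact ⟨fun _ h => absurd h (hno _ _), fun _ _ h => absurd h (hno _ _)⟩
  · exact hs.congr (by simp) rfl rfl rfl
  · intro i hi s' h h3 hr ha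
    have hi' : i < n ^ 3 := hi.trans_le <| by
      have := Nat.mul_le_mul_right (n ^ 3) (min_le_right (k - 1) 1)
      rwa [one_mul] at this
    have hn0 : 0 < n := Nat.pos_of_ne_zero fun h => by simp [h] at hi'
    obtain ⟨v, w, hvw, hv, hw⟩ := exists_fin_index (n := n) (i := i / n)
      (Nat.div_lt_of_lt_mul (by rw [← sq, ← pow_succ']; exact hi'))
    set u : Fin n := ⟨i % n, Nat.mod_lt _ hn0⟩ with hu
    have hiu : i % n = u := rfl
    have hi_eq : ((v : ℕ) * n + w) * n + u = i := by
      rw [hvw, ← hiu]; exact Nat.div_add_mod' i n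
    rw [Nat.div_div_eq_div_mul] at hv
    have hsplit : ∀ v' w' u' : Fin n, ((v' : ℕ) * n + w') * n + u' < i + 1 ↔
        ((v' : ℕ) * n + w') * n + u' < i ∨ v' = v ∧ w' = w ∧ u' = u := fun v' w' u' => by
      have : ((v' : ℕ) * n + w') * n + u' = i ↔ v' = v ∧ w' = w ∧ u' = u := by
        rw [← hi_eq, mul_add_inj u'.isLt u.isLt, fin_index_inj, and_assoc, Fin.ext_iff (a := u')]
      rw [← this]; omega
    have hE : ∀ x : ℕ → ZMod 2, (Q ∧ ∀ v w u : Fin n, ((v : ℕ) * n + w) * n + u < i + 1 →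
        EndEquation (crossGraph G col) (fun v w => x (v * n + w)) v w u) ↔
        ((Q ∧ ∀ v w u : Fin n, ((v : ℕ) * n + w) * n + u < i →
        EndEquation (crossGraph G col) (fun v w => x (v * n + w)) v w u) ∧
        EndEquation (crossGraph G col) (fun v w => x (v * n + w)) v w u) := by
      intro x
      rw [and_assoc]
      refine and_congr_right fun _ => ⟨fun h => ⟨fun v' w' u' h' => h v' w' u' ?_, h v w u ?_⟩,
        fun h v' w' u' h' => ?_⟩
      · exact (hsplit _ _ _).2 (.inl h')
      · exact (hsplit _ _ _).2 (.inr ⟨rfl, rfl, rfl⟩)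
      · rcases (hsplit _ _ _).1 h' with h' | ⟨rfl, rfl, rfl⟩
        exacts [h.1 _ _ _ h', h.2]
    have h0 : s'.reg 0 = n := by rw [hr 0 (by simp [equationLoop, regs]; decide), hn]
    have h8 : s'.arr 8 = s.arr 8 := ha 8 (by simp [equationLoop, arrs]; decide)
    have hnn : n ≤ n * n := Nat.le_mul_of_pos_left n hn0
    have hlt : ∀ v : Fin n, (v : ℕ) % M = v := fun v => Nat.mod_eq_of_lt (by omega)
    have hlt₂ : ∀ v w : Fin n, ((v : ℕ) * n + w) % M = v * n + w := fun v w =>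
      Nat.mod_eq_of_lt ((fin_index_lt v w).trans_le (by omega))
    have hBvw := hB v w
    have hBvu := hB v u
    have hBwu := hB w u
    have h1M : 1 % M = 1 := Nat.mod_eq_of_lt (by omega)
    simp only [den_seq, den_assign, den_ite, den_skip, value_div, value_mod, value_mul, value_reg,
      value_add, value_sub, value_one, value_load, value_eq, State.setReg_reg, State.setReg_arr,
      Nat.reduceEqDiff, if_true, if_false, OfNat.zero_ne_ofNat, h3, h0, h8, hv, hw, hiu, hlt, hBvw, hBvu,
      hBwu]
    by_cases hact : (crossGraph G col).Adj v w ∧ (crossGraph G col).Adj v u ∧ w ≠ u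
    · obtain ⟨h1, h2, hne⟩ := hact
      simp only [h1, h2, Fin.val_ne_iff.2 hne, if_true, if_false, mul_one, Nat.sub_zero,
        one_ne_zero, hlt₂]
      have main : ∀ J₃ J₄ b : ℕ, J₃ < n * n → J₄ < n * n →
          (∀ x : ℕ → ZMod 2, EndEquation (crossGraph G col) (fun v w => x (v * n + w)) v w u ↔
            x (v * n + w) + x (v * n + u) + (x J₃ + x J₄) + b = 0) →
          Solves (n * n) (fun x => Q ∧ ∀ v w u : Fin n, ((v : ℕ) * n + w) * n + u < i + 1 →
            EndEquation (crossGraph G col) (fun v w => x (v * n + w)) v w u)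
            ((den n M addEquation ((((((((s'.setReg 4 v).setReg 5 w).setReg 6 u).setReg 7
              (v * n + w)).setReg 8 (v * n + u)).setReg 9 J₃).setReg 10 J₄).setReg 11 b)).setReg 3
              (i + 1)) := by
        intro J₃ J₄ b h₃ h₄ heq
        set t := (((((((s'.setReg 4 v).setReg 5 w).setReg 6 u).setReg 7
              (v * n + w)).setReg 8 (v * n + u)).setReg 9 J₃).setReg 10 J₄).setReg 11 b with ht
        have hst := solves_addEquation (s := t) hM (by simp [ht, h0])
          (by simpa [ht] using fin_index_lt v w) (by simpa [ht] using fin_index_lt v u)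
          (by simpa [ht] using h₃) (by simpa [ht] using h₄) ?_
          (h.congr (fun _ => Iff.rfl) (by simp [ht]) (by simp [ht]) (by simp [ht]))
        · refine hst.congr (fun x => ?_) (by simp) (by simp) (by simp)
          rw [hE, heq]
          simp [ht, EquationHolds]
        · rintro x y hxy ⟨hQ, hx⟩
          have hxy' : (fun v w : Fin n => x (v * n + w)) = fun v w : Fin n => y (v * n + w) := by
            funext v w
            exact hxy _ (fin_index_lt v w)
          exact ⟨hQ, hxy' ▸ hx⟩
      by_cases h3' : (crossGraph G col).Adj w u
      · simp only [h3', if_true, one_mul, hlt₂, Nat.sub_self, Nat.zero_mod]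
        refine main _ _ _ (fin_index_lt _ _) (fin_index_lt _ _) fun x => ?_
        simp [EndEquation, h1, h2, hne, h3', add_assoc]
      · simp only [h3', if_false, zero_mul, Nat.zero_mod, Nat.sub_zero, h1M]
        have h00 : 0 < n * n := Nat.mul_pos hn0 hn0
        -- The two unused index registers both contain `0`; their terms cancel in characteristic
        -- two.
        refine main _ _ _ h00 h00 fun x => ?_
        simp [EndEquation, h1, h2, hne, h3', CharTwo.add_self_eq_zero]
    · rw [if_pos]
      · refine h.congr (fun x => ?_) (by simp) (by simp) (by simp)
        rw [hE, iff_self_and]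
        exact fun _ h1 h2 h3 => absurd ⟨h1, h2, h3⟩ hact
      · by_contra hcond
        refine hact ⟨?_, ?_, ?_⟩
        · by_contra h1
          simp only [h1, if_false, zero_mul, not_true_eq_false] at hcond
        · by_contra h2
          simp only [h2, if_false, mul_zero, zero_mul, not_true_eq_false] at hcond
        · intro h3
          simp only [h3, if_true, Nat.sub_self, mul_zero, not_true_eq_false] at hcond

/-- Find the smallest numbers of the ends that are equal to the ends of `reg 3`. -/
def findEnds : LoopProg :=
  loop 4 1 1 (ite (load 8 (reg 3 * reg 0 + reg 4))
    (ite (load 10 (reg 3 * reg 0 + reg 4) % 2)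
      (assign 6 (reg 6 - (reg 6 - (reg 4 + reg 4 + load 10 (reg 4 * reg 0 + reg 3) % 2))))
      (assign 5 (reg 5 - (reg 5 - (reg 4 + reg 4 + load 10 (reg 4 * reg 0 + reg 3) % 2)))))
    skip)

/-- Output the root graph. -/
def outputLoop : LoopProg :=
  loop 3 1 1 (assign 5 (reg 3 + reg 3) ;; assign 6 (reg 3 + reg 3 + 1) ;; findEnds ;;
    store 0 (reg 3) (reg 5) ;; store 1 (reg 3) (reg 6) ;; store 2 (reg 3) (load 7 (reg 3)))

theorem den_findEnds {n M : ℕ} {B : SimpleGraph (Fin n)} [DecidableRel B.Adj] {s : State}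
    (hM : 2 * n < M) (hn : s.reg 0 = n)
    (hB : ∀ v w : Fin n, s.arr 8 (v * n + w) = if B.Adj v w then 1 else 0) {v : Fin n}
    (h3 : s.reg 3 = v) (h5 : s.reg 5 = v + v) (h6 : s.reg 6 = v + v + 1) :
    IsLeast (endClass B (fun v w => (s.arr 10 (v * n + w) : ZMod 2)) (v, 0))
      ((den n M findEnds s).reg 5) ∧
    IsLeast (endClass B (fun v w => (s.arr 10 (v * n + w) : ZMod 2)) (v, 1))
      ((den n M findEnds s).reg 6) := by
  set x : Fin n → Fin n → ZMod 2 := fun v w => (s.arr 10 (v * n + w) : ZMod 2) with hx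
  set S : ZMod 2 → ℕ → Set ℕ := fun a i => {y | y = 2 * v + a.val ∨
    ∃ w : Fin n, w.val < i ∧ B.Adj v w ∧ x v w = a ∧ y = 2 * w + (x w v).val} with hS
  have hSn : ∀ a, S a n = endClass B x (v, a) := by
    intro a
    ext y
    simp only [hS, endClass, Set.mem_ofPred_eq, SameEnd]
    constructor
    · rintro (h | ⟨w, -, h1, h2, h3⟩)
      · exact ⟨(v, a), .inl rfl, h⟩
      · exact ⟨(w, x w v), .inr ⟨h1, h2, rfl⟩, h3⟩
    · rintro ⟨⟨w, b⟩, h | ⟨h1, h2, h3⟩, hy⟩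
      · obtain ⟨rfl, rfl⟩ := Prod.mk.inj h
        exact .inl hy
      · simp only at h1 h2 h3 hy
        exact .inr ⟨w, w.isLt, h1, h2, by rw [h3]; exact hy⟩
  have key := den_loop (n := n) (M := M) (s := s) findEnds n rfl (by ring)
    (fun i s' => IsLeast (S 0 i) (s'.reg 5) ∧ IsLeast (S 1 i) (s'.reg 6)) ?_ ?_
  · rwa [hSn, hSn] at key
  · simp [hS, h5, h6, two_mul, ZMod.val_one]
  · rintro i hi s' ⟨h1, h2⟩ h4 hr ha
    have h0' : s'.reg 0 = n := by rw [hr 0 (by decide), hn]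
    have h3' : s'.reg 3 = v := by rw [hr 3 (by decide), h3]
    set w : Fin n := ⟨i, hi⟩ with hw
    have hiw : i = w := rfl
    have hsucc : ∀ a, S a (i + 1) = if B.Adj v w ∧ x v w = a then
        insert (2 * w + (x w v).val) (S a i) else S a i := by
      intro a
      have hlt : ∀ w' : Fin n, w'.val < i + 1 ↔ w'.val < i ∨ w' = w := fun w' => by
        rw [Nat.lt_succ_iff_lt_or_eq, Fin.ext_iff]
      ext y
      split_ifs with hc
      · simp only [hS, Set.mem_ofPred_eq, Set.mem_insert_iff, hlt]
        constructor
        · rintro (h | ⟨w', h | rfl, h'⟩)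
          · exact .inr (.inl h)
          · exact .inr (.inr ⟨w', h, h'⟩)
          · exact .inl h'.2.2
        · rintro (h | h | ⟨w', h, h'⟩)
          · exact .inr ⟨w, .inr rfl, hc.1, hc.2, h⟩
          · exact .inl h
          · exact .inr ⟨w', .inl h, h'⟩
      · simp only [hS, Set.mem_ofPred_eq, hlt]
        refine or_congr_right (exists_congr fun w' => and_congr_left fun h' =>
          or_iff_left ?_)
        rintro rfl
        exact hc ⟨h'.1, h'.2.1⟩
    have hval : ∀ a b : Fin n, s.arr 10 (a * n + b) % 2 = (x a b).val := fun a b => by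
      rw [hx, ZMod.val_natCast]
    have hle : ∀ a i, ∀ m, IsLeast (S a i) m → m < M := fun a i m hm => by
      have h1 := hm.2 (show 2 * (v : ℕ) + a.val ∈ S a i from .inl rfl)
      have := ZMod.val_two_le_one a
      omega
    -- With truncated subtraction, `m - (m - b)` is the minimum of `m` and `b`.
    have hmin : ∀ a m, IsLeast (S a i) m → IsLeast (insert (2 * w + (x w v).val) (S a i))
        ((m - (m - (w + w + (x w v).val))) % M) := fun a m hm => by
      have := hle a i m hm
      rw [Nat.mod_eq_of_lt (by omega), Nat.sub_sub_eq_min, min_comm, ← two_mul]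
      exact hm.insert _
    simp only [den_ite, den_assign, den_skip, value_load, value_add, value_sub, value_mul,
      value_mod, value_two, value_reg, h4, h3', h0', ha 8 (by decide), ha 10 (by decide), hiw, hB,
      hval]
    rw [← hiw, hsucc, hsucc]
    by_cases hc : B.Adj v w
    · rcases ZMod.two_cases (x v w) with h | h
      · simpa [hc, h] using ⟨hmin 0 _ h1, h2⟩
      · simpa [hc, h, ZMod.val_one] using ⟨h1, hmin 1 _ h2⟩
    · simpa [hc] using ⟨h1, h2⟩

theorem den_outputLoop {n M : ℕ} {B : SimpleGraph (Fin n)} [DecidableRel B.Adj] {s : State}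
    (hM : 2 * n < M) (hn : s.reg 0 = n)
    (hB : ∀ v w : Fin n, s.arr 8 (v * n + w) = if B.Adj v w then 1 else 0)
    {col : Fin n → ℕ} (hcol : ∀ v : Fin n, s.arr 7 v = col v) (hcolM : ∀ v, col v < M) :
    (∀ v a, IsLeast (endClass B (fun v w => (s.arr 10 (v * n + w) : ZMod 2)) (v, a))
      ((den n M outputLoop s).arr a.val v)) ∧
    ∀ v : Fin n, (den n M outputLoop s).arr 2 v = col v := by
  set x : Fin n → Fin n → ZMod 2 := fun v w => (s.arr 10 (v * n + w) : ZMod 2) with hx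
  have key := den_loop (n := n) (M := M) (s := s) outputLoop n rfl (by ring)
    (fun i s' => ∀ v : Fin n, v.val < i → IsLeast (endClass B x (v, 0)) (s'.arr 0 v) ∧
      IsLeast (endClass B x (v, 1)) (s'.arr 1 v) ∧ s'.arr 2 v = col v) ?_ ?_
  · refine ⟨fun v a => ?_, fun v => (key v v.isLt).2.2⟩
    rcases ZMod.two_cases a with rfl | rfl
    exacts [(key v v.isLt).1, (key v v.isLt).2.1]
  · simp
  · intro i hi s' h h3 hr ha v hv
    set t := (s'.setReg 5 (i + i)).setReg 6 (i + i + 1) with ht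
    have a8 : t.arr 8 = s.arr 8 := by simp [ht, ha 8 (by decide)]
    have a10 : t.arr 10 = s.arr 10 := by simp [ht, ha 10 (by decide)]
    obtain ⟨h5, h6⟩ := den_findEnds (s := t) (B := B) (v := ⟨i, hi⟩) hM
      (by simp [ht, hr 0 (by decide), hn]) (by simpa [a8] using hB) (by simp [ht, h3])
      (by simp [ht]) (by simp [ht])
    rw [a10, ← hx] at h5 h6
    have hlt : ∀ a m, IsLeast (endClass B x (⟨i, hi⟩, a)) m → m % M = m := fun a m hm => by
      have h1 := hm.2 ⟨(⟨i, hi⟩, a), .inl rfl, rfl⟩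
      have := ZMod.val_two_le_one a
      simp only at h1
      exact Nat.mod_eq_of_lt (by omega)
    have e1 : (i + i) % M = i + i := Nat.mod_eq_of_lt (by omega)
    have e2 : (i + i + 1) % M = i + i + 1 := Nat.mod_eq_of_lt (by omega)
    have htr : (den n M findEnds t).reg 3 = i := by
      rw [den_reg _ _ _ (by decide)]; simp [ht, h3]
    have hta : (den n M findEnds t).arr = s'.arr := by
      funext b
      rw [den_arr _ _ _ (by simp [findEnds, arrs])]; simp [ht]
    simp only [den_seq, den_assign, den_store, value_add, value_reg, value_one, value_load,
      State.setReg_reg, Nat.reduceEqDiff, if_false, h3, e1, e2, ← ht]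
    rcases Nat.lt_succ_iff_lt_or_eq.1 hv with hv | hv
    · simpa [htr, hv.ne, hta] using h v hv
    · obtain rfl : v = ⟨i, hi⟩ := Fin.ext hv
      have hc : col ⟨i, hi⟩ % M = col ⟨i, hi⟩ := Nat.mod_eq_of_lt (hcolM _)
      have a7 : s.arr 7 i = col ⟨i, hi⟩ := hcol ⟨i, hi⟩
      simpa [htr, hta, hlt _ _ h5, hlt _ _ h6, ha 7 (by decide), a7, hc] using ⟨h5, h6⟩

end WordRAM.LoopProg

/-! ## The algorithm -/

namespace WordRAM.LoopProg

open Exp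

/-- Test the coloring with the code in register `2`, and output a root graph if there is one. -/
def tryCode (k : ℕ) : LoopProg :=
  assign 3 (reg 2) ;; colorLoop k ;; assign 12 1 ;; crossLoop ;; initSystem ;; equationLoop k ;;
  ite (reg 12) (assign 18 1 ;; outputLoop) skip

/-- The coloring is the edge coloring of some root graph. -/
def IsRootColoring {n : ℕ} (G : SimpleGraph (Fin n)) (col : Fin n → ℕ) : Prop :=
  IsCliqueColoring G col ∧ ∃ x, IsEndSystem (crossGraph G col) x

/-- The arrays `0`, `1`, `2` describe a root graph with `p` vertices. -/
def DescribesRoot (k : ℕ) {n : ℕ} (G : SimpleGraph (Fin n)) (p : ℕ) (s : State) : Prop :=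
  ∃ (H : SimpleGraph (Fin p)) (φ : H.edgeSet → Fin k) (ι : G ≃g colorLineGraph H φ),
    IsProperEdgeColoring H φ ∧
      ∀ i : Fin n, (ι i : Sym2 (Fin p)).map Fin.val = s(s.arr 0 i, s.arr 1 i) ∧
        (φ (ι i) : ℕ) = s.arr 2 i

theorem exists_flatten {n : ℕ} (x : Fin n → Fin n → ZMod 2) :
    ∃ y : ℕ → ZMod 2, ∀ v w : Fin n, y (v * n + w) = x v w := by
  have hinj : Function.Injective fun p : Fin n × Fin n => (p.1 : ℕ) * n + p.2 := fun p q h =>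
    Prod.ext_iff.2 (fin_index_inj.1 h)
  exact ⟨Function.extend (fun p : Fin n × Fin n => (p.1 : ℕ) * n + p.2) (fun p => x p.1 p.2) 0,
    fun v w => hinj.extend_apply _ _ (v, w)⟩

-- A root graph is output for every code that passes the tests, whether or not the representatives
-- behave as they would in a color-line graph. A failing code leaves the arrays `0`, `1`, `2` and
-- the flag untouched, so a root graph found earlier survives.
open scoped Classical in
theorem den_tryCode {n M k : ℕ} {G : SimpleGraph (Fin n)} {rep : Fin n → Fin n} {s : State}
    (hk : 0 < k) (hkM : k ≤ M) (hM : n * n + 2 ≤ M) (hM' : 2 * n < M) (h2 : s.reg 2 < M)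
    (hs : Prepared G rep s) (hrep : ∀ v, rep v ≤ v) :
    (IsRootColoring G (decode k rep (s.reg 2)) → (den n M (tryCode k) s).reg 18 = 1 ∧
      DescribesRoot k G (2 * n) (den n M (tryCode k) s)) ∧
    (¬ IsRootColoring G (decode k rep (s.reg 2)) →
      (den n M (tryCode k) s).reg 18 = s.reg 18 ∧
      ∀ b < 3, (den n M (tryCode k) s).arr b = s.arr b) := by
  set c := s.reg 2 with hc
  set col := decode k rep c with hcol
  have hcolk : ∀ v, col v < k := fun v => Nat.mod_lt _ hk
  have h1M : 1 % M = 1 := Nat.mod_eq_of_lt (by omega)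
  set s₁ := den n M (colorLoop k) (s.setReg 3 c) with hs₁
  set s₂ := den n M crossLoop (s₁.setReg 12 1) with hs₂
  set s₃ := den n M initSystem s₂ with hs₃
  set s₄ := den n M (equationLoop k) s₃ with hs₄
  have hden : den n M (tryCode k) s =
      if s₄.reg 12 = 0 then s₄ else den n M outputLoop (s₄.setReg 18 1) := by
    simp only [tryCode, den_seq, den_assign, den_ite, den_skip, value_reg, value_one, ← hc,
      Nat.mod_eq_of_lt h2, h1M, ← hs₁, ← hs₂, ← hs₃, ← hs₄]
  have hprep : Prepared G rep (s.setReg 3 c) := ⟨by simp [hs.size], hs.adj, hs.reps, hs.mark⟩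
  have h7 : ∀ v : Fin n, s₁.arr 7 v = col v := fun v => by
    rw [hs₁, den_colorLoop hk hkM (by simpa using h2) hprep hrep]
    simp [hcol]
  have r₁ : ∀ y, y ∉ (colorLoop k).regs → y ≠ 3 → s₁.reg y = s.reg y := fun y hy hy' => by
    rw [hs₁, den_reg _ _ _ hy]; simp [hy']
  have a₁ : ∀ b, b ∉ (colorLoop k).arrs → s₁.arr b = s.arr b := fun b hb => by
    rw [hs₁, den_arr _ _ _ hb]; simp
  have h01 : s₁.reg 0 = n := by
    rw [r₁ 0 (by simp [colorLoop, regs]) (by decide), hs.size]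
  have hG : HasAdjMatrix G (s₁.setReg 12 1) := by
    have := a₁ 3 (by simp [colorLoop, arrs])
    simpa [HasAdjMatrix, this] using hs.adj
  obtain ⟨hB, hclique⟩ := den_crossLoop (M := M) (s := s₁.setReg 12 1) (by omega) (by simp [h01]) hG
    (col := col) (by simpa using h7) (by simp)
  rw [← hs₂] at hB hclique
  have r₂ : ∀ y, y ∉ crossLoop.regs → y ≠ 12 → s₂.reg y = s₁.reg y := fun y hy hy' => by
    rw [hs₂, den_reg _ _ _ hy]; simp [hy']
  have a₂ : ∀ b, b ∉ crossLoop.arrs → s₂.arr b = s₁.arr b := fun b hb => by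
    rw [hs₂, den_arr _ _ _ hb]; simp
  have h02 : s₂.reg 0 = n := by rw [r₂ 0 (by decide) (by decide), h01]
  have h12 : s₃.reg 12 = s₂.reg 12 := by rw [hs₃, den_reg _ _ _ (by decide)]
  have hsolve : Solves (n * n) (fun _ => IsCliqueColoring G col) s₃ := by
    refine ⟨fun h _ => hclique.1 (h12 ▸ h), fun x _ j hj => den_initSystem (by omega) h02 x hj,
      fun h _ hcl => hclique.2 hcl (h12 ▸ h)⟩
  have h03 : s₃.reg 0 = n := by rw [hs₃, den_reg _ _ _ (by decide), h02]
  have hB₃ : HasCrossMatrix G col s₃ := by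
    have : s₃.arr 8 = s₂.arr 8 := by rw [hs₃, den_arr _ _ _ (by decide)]
    simpa [HasCrossMatrix, this] using hB
  have hfin := solves_equationLoop hM hcolk h03 hB₃ hsolve
  rw [← hs₄] at hfin
  have harr₄ : ∀ b, b < 9 → s₄.arr b = s₃.arr b := fun b hb => by
    rw [hs₄, den_arr]
    simp [equationLoop, arrs, addEquation, addRows, substitute, substituteRow]
    omega
  have harr₃ : ∀ b, b < 9 → s₃.arr b = s₂.arr b := fun b hb => by
    rw [hs₃, den_arr]
    simp [initSystem, arrs]
    omega
  have h04 : s₄.reg 0 = n := by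
    rw [hs₄, den_reg _ _ _ (by simp [equationLoop, regs]; decide), h03]
  have h18 : s₄.reg 18 = s.reg 18 := by
    rw [hs₄, den_reg _ _ _ (by simp [equationLoop, regs]; decide), hs₃,
      den_reg _ _ _ (by decide), r₂ 18 (by decide) (by decide),
      r₁ 18 (by simp [colorLoop, regs]) (by decide)]
  rw [hden]
  by_cases h12' : s₄.reg 12 = 0
  · rw [if_pos h12']
    refine ⟨fun ⟨h1, x, hx⟩ => ?_, fun _ => ⟨h18, fun b hb => ?_⟩⟩
    · obtain ⟨y, hy⟩ := exists_flatten x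
      refine absurd ⟨h1, ?_⟩ (hfin.unsolvable h12' y)
      simp only [hy]
      exact hx
    · rw [harr₄ b (by omega), harr₃ b (by omega), a₂ b, a₁ b]
      · simp [colorLoop, arrs]; omega
      · simp [crossLoop, arrs]; omega
  · rw [if_neg h12']
    -- At the parameter `0` the affine map returns its constant terms, so array `10` itself is a
    -- solution.
    obtain ⟨h1, h2⟩ := hfin.sound h12' 0
    have hx : IsEndSystem (crossGraph G col)
        (fun v w => ((s₄.setReg 18 1).arr 10 (v * n + w) : ZMod 2)) := by
      simpa [affine] using h2
    refine ⟨fun _ => ⟨?_, ?_⟩, fun h => absurd ⟨h1, _, hx⟩ h⟩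
    · rw [den_reg _ _ _ (by decide)]; simp
    · obtain ⟨hout, hout'⟩ := den_outputLoop (s := s₄.setReg 18 1) (B := crossGraph G col)
        (col := col) hM' (by simp [h04])
        (by rw [State.setReg_arr, harr₄ 8 (by omega)]; exact hB₃)
        (by simpa [harr₄, harr₃, a₂ 7 (by decide)] using h7) fun v => (hcolk v).trans_le hkM
      obtain ⟨H, φ, ι, hφ, hι⟩ := hx.exists_root hcolk h1 hout rfl
      exact ⟨H, φ, ι, hφ, fun i => ⟨(hι i).1, (hι i).2.trans (hout' i).symm⟩⟩

/-- Test all colorings of at most `R` representatives. -/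
def codeLoop (k R : ℕ) : LoopProg := loop 2 (k ^ R) 0 (tryCode k)

-- The search does not stop at a success. A later success overwrites the output by another root
-- graph, which is just as good.
open scoped Classical in
theorem den_codeLoop {n M k R : ℕ} {G : SimpleGraph (Fin n)} {rep : Fin n → Fin n} {s : State}
    (hk : 0 < k) (hkM : k ≤ M) (hM : n * n + 2 ≤ M) (hM' : 2 * n < M) (hR : k ^ R ≤ M)
    (hs : Prepared G rep s) (hrep : ∀ v, rep v ≤ v) (h18 : s.reg 18 = 0) :
    ((den n M (codeLoop k R) s).reg 18 = 0 ∧ ∀ c < k ^ R, ¬ IsRootColoring G (decode k rep c)) ∨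
      ((den n M (codeLoop k R) s).reg 18 = 1 ∧
        DescribesRoot k G (2 * n) (den n M (codeLoop k R) s)) := by
  refine den_loop (n := n) (M := M) (s := s) (codeLoop k R) (k ^ R) rfl (by simp)
    (fun i s' => (s'.reg 18 = 0 ∧ ∀ c < i, ¬ IsRootColoring G (decode k rep c)) ∨
      (s'.reg 18 = 1 ∧ DescribesRoot k G (2 * n) s')) ?_ ?_
  · simp [h18]
  · intro i hi s' h h2 hr ha
    have harr : ∀ b, b ∈ [3, 4, 5] → s'.arr b = s.arr b := fun b hb => ha b <| by
      simp only [List.mem_cons, List.not_mem_nil, or_false] at hb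
      rcases hb with rfl | rfl | rfl <;>
      simp [codeLoop, tryCode, arrs, colorLoop, crossLoop, initSystem, equationLoop, addEquation,
        addRows, substitute, substituteRow, outputLoop, findEnds]
    have hs' : Prepared G rep s' := by
      refine ⟨?_, ?_, ?_, ?_⟩
      · rw [hr 0, hs.size]
        simp [codeLoop, tryCode, regs, colorLoop, crossLoop, initSystem, equationLoop, addEquation,
          addRows, substitute, substituteRow, outputLoop, findEnds]
      · simpa [HasAdjMatrix, harr 3 (by simp)] using hs.adj
      · simpa [harr 4 (by simp)] using hs.reps
      · simpa [harr 5 (by simp)] using hs.mark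
    obtain ⟨h3, h4⟩ := den_tryCode hk hkM hM hM' (by omega : s'.reg 2 < M) hs' hrep
    rw [h2] at h3 h4
    simp only [State.setReg_reg, Nat.reduceEqDiff, if_false]
    by_cases hv : IsRootColoring G (decode k rep i)
    · exact .inr (h3 hv)
    · obtain ⟨h5, h6⟩ := h4 hv
      rw [h5]
      refine h.imp (fun h => ⟨h.1, fun c hc => ?_⟩) fun h => ⟨h.1, ?_⟩
      · rcases Nat.lt_succ_iff_lt_or_eq.1 hc with hc | rfl
        exacts [h.2 c hc, hv]
      · simpa [DescribesRoot, h6] using h.2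

/-- The algorithm. Register `18` becomes `1` if a root graph has been found. -/
def findRoot (k : ℕ) : LoopProg :=
  loadMatrix ;; findReps k ;; codeLoop k ((2 * k + 2) * k)

theorem den_findRoot {n M k : ℕ} {G : SimpleGraph (Fin n)} {L : List (Fin n × Fin n)}
    (hL : IsEdgeList G L) (hk : 0 < k) (hkM : k ≤ M) (hM : n * n + 2 ≤ M) (hM' : 2 * n < M)
    (hR : k ^ ((2 * k + 2) * k) ≤ M) :
    ((den n M (findRoot k) (inputState n L)).reg 18 = 0 ∧ ¬ IsProperColorLineGraph k G) ∨
      ((den n M (findRoot k) (inputState n L)).reg 18 = 1 ∧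
        DescribesRoot k G (2 * n) (den n M (findRoot k) (inputState n L))) := by
  classical
  obtain ⟨rep, hrep⟩ := exists_isRep k G
  have hG := hasAdjMatrix_loadMatrix hL (M := M) (by omega)
  set s₁ := den n M loadMatrix (inputState n L) with hs₁
  have h01 : s₁.reg 0 = n := by rw [hs₁, den_reg _ _ _ (by decide)]; simp [inputState]
  have h5 : s₁.arr 5 = fun _ => 0 := by
    rw [hs₁, den_arr _ _ _ (by decide)]; funext; simp [inputState]
  have hs := prepared_findReps (M := M) (by omega) (by omega) h01 hG h5 hrep
  set s₂ := den n M (findReps k) s₁ with hs₂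
  have h18 : s₂.reg 18 = 0 := by
    rw [hs₂, den_reg _ _ _ (by simp [findReps, findRep, regs, countCommon]), hs₁,
      den_reg _ _ _ (by decide)]
    simp [inputState]
  have hden : den n M (findRoot k) (inputState n L) =
      den n M (codeLoop k ((2 * k + 2) * k)) s₂ := rfl
  rw [hden]
  refine (den_codeLoop hk hkM hM hM' hR hs (fun v => (hrep v).2 (.inl rfl)) h18).imp
    (fun h => ⟨h.1, fun hcl => ?_⟩) id
  -- The coloring of an actual root graph is constant along `rep`, hence it is one of the tested
  -- codes and cannot have been rejected.
  obtain ⟨col, hcolk, hcol, h2, hx⟩ := hcl.exists_coloring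
  obtain ⟨c, hc, hdec⟩ := exists_decode (hrep.card_image_le hcolk hcol h2) hcolk hk
    (hrep.col_eq hcolk h2)
  exact h.2 c hc (hdec ▸ ⟨hcol, hx⟩)

/-- The summands of the exponent make room for the number of codes, for the colors, and for the loop
bounds up to `n ^ 3`. -/
theorem findRoot_wf (k : ℕ) : (findRoot k).WF (k ^ ((2 * k + 2) * k) + k + 5) := by
  simp only [findRoot, loadMatrix, findReps, findRep, countCommon, codeLoop, tryCode, colorLoop,
    crossLoop, initSystem, equationLoop, addEquation, addRows, substitute, substituteRow,
    outputLoop, findEnds, WF, regs]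
  simp
  omega

/-- The loop over the equations has exponent `3 + 4 = 7`, which is at most `k + 5` when `k ≥ 2`. For
`k = 1` its bound is `0` and it contributes nothing; all other parts have exponent at most `4`. -/
theorem findRoot_depth {k : ℕ} (hk : 1 ≤ k) : (findRoot k).depth ≤ k + 5 := by
  simp only [findRoot, loadMatrix, findReps, findRep, countCommon, codeLoop, tryCode, colorLoop,
    crossLoop, initSystem, equationLoop, addEquation, addRows, substitute, substituteRow,
    outputLoop, findEnds, depth]
  split_ifs <;> simp <;> omega

end WordRAM.LoopProg

/-! ### Size of the input, final time bound and the main theorem. -/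

theorem bounded_inputState {n a : ℕ} {G : SimpleGraph (Fin n)} {L : List (Fin n × Fin n)}
    (hL : IsEdgeList G L) (ha : 2 ≤ a) : (inputState n L).Bounded ((n + 2) ^ a) := by
  have h1 : (n + 2) ^ 2 ≤ (n + 2) ^ a := Nat.pow_le_pow_right (by omega) ha
  have h2 := WordRAM.LoopProg.length_le_of_isEdgeList hL
  have h3 : (n + 2) ^ 2 = n * n + 4 * n + 4 := by ring
  refine ⟨fun x => ?_, fun b i => ?_⟩
  · simp only [inputState]
    split_ifs <;> omega
  · simp only [inputState]
    split_ifs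
    · cases L[i]? with
      | none => simp
      | some p => have := p.1.isLt; simp only [Option.elim_some]; omega
    · cases L[i]? with
      | none => simp
      | some p => have := p.2.isLt; simp only [Option.elim_some]; omega
    · omega

/-- For `n ≥ 1` one has `n + 1 ≤ 2 * n`; for `n = 0` the added `1` on the right takes over. The `6`
is the cost of the two final assignments. -/
theorem time_bound {n k d m : ℕ} (C : ℕ) (hd : d ≤ k + 5) :
    C * (n + 1) ^ d + 6 ≤ (C + 6) * 2 ^ (k + 5) * (n ^ (k + 4) * (n + m) + 1) := by
  have h1 : (n + 1) ^ d ≤ 2 ^ (k + 5) * (n ^ (k + 4) * (n + m) + 1) := by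
    rcases Nat.eq_zero_or_pos n with rfl | hn
    · simpa using Nat.one_le_two_pow
    · calc (n + 1) ^ d ≤ (n + 1) ^ (k + 5) := Nat.pow_le_pow_right (by omega) hd
        _ ≤ (2 * n) ^ (k + 5) := Nat.pow_le_pow_left (by omega) _
        _ = 2 ^ (k + 5) * (n ^ (k + 4) * n) := by rw [mul_pow]; ring
        _ ≤ _ := Nat.mul_le_mul_left _ (Nat.le_succ_of_le (Nat.mul_le_mul_left _ (by omega)))
  have h2 : 1 ≤ 2 ^ (k + 5) * (n ^ (k + 4) * (n + m) + 1) :=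
    Nat.mul_pos (by positivity) (by omega)
  rw [mul_assoc, add_mul]
  exact add_le_add (Nat.mul_le_mul_left _ h1) (Nat.mul_le_mul_left 6 h2)

theorem mainTheorem2 (k : ℕ) (hk : 1 ≤ k) :
    ∃ (P : WordRAM.Prog) (w C : ℕ),
      ∀ (n : ℕ) (G : SimpleGraph (Fin n)) (L : List (Fin n × Fin n)), IsEdgeList G L →
        ∃ (s : WordRAM.State) (t : ℕ),
          WordRAM.Exec ((n + 2) ^ w) P (inputState n L) s t ∧
          t ≤ C * (n ^ (k + 4) * (n + G.edgeSet.ncard) + 1) ∧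
          (IsProperColorLineGraph k G → s.reg 0 = 1 ∧ OutputsRoot k G s) ∧
          (¬ IsProperColorLineGraph k G → s.reg 0 = 0) := by
  set a := k ^ ((2 * k + 2) * k) + k + 5 with ha
  have hwf := WordRAM.LoopProg.findRoot_wf k
  rw [← ha] at hwf
  obtain ⟨w, C, h⟩ := WordRAM.LoopProg.exists_exec a _ hwf
  -- The number `2 * n` of root vertices is written to register `1` before register `0`, which still
  -- contains `n`, is overwritten by the answer.
  refine ⟨.seq ((WordRAM.LoopProg.findRoot k).compile a)
    (.seq (.assign 1 (.bin .add (.reg 0) (.reg 0))) (.assign 0 (.reg 18))), w + a, (C + 6) * 2 ^ (k + 5),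
    fun n G L hL => ?_⟩
  have hb := bounded_inputState hL (a := a) (by omega)
  obtain ⟨t, ht, hexec⟩ := h n (w + a) (inputState n L) (by simp [inputState]) hb (by omega)
  set M := (n + 2) ^ a with hM
  have hMW : M ≤ (n + 2) ^ (w + a) := Nat.pow_le_pow_right (by omega) (by omega)
  have hpow : ∀ b, b ≤ a → (n + 2) ^ b ≤ M := fun b hb => Nat.pow_le_pow_right (by omega) hb
  have h2 := hpow 2 (by omega)
  have h3 : (n + 2) ^ 2 = n * n + 4 * n + 4 := by ring
  have hroot := WordRAM.LoopProg.den_findRoot hL hk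
    ((WordRAM.lt_add_two_pow k n).le.trans (hpow k (by omega))) (by omega) (by omega)
    ((WordRAM.lt_add_two_pow _ n).le.trans (hpow _ (by omega)))
  have hb' := WordRAM.LoopProg.den_bounded _ hwf hb
  set s₁ := WordRAM.LoopProg.den n M (WordRAM.LoopProg.findRoot k) (inputState n L) with hs₁
  have h0 : s₁.reg 0 = n := by
    rw [hs₁, WordRAM.LoopProg.den_reg _ _ _ (WordRAM.LoopProg.zero_notMem_regs _ hwf)]
    simp [inputState]
  refine ⟨(s₁.setReg 1 (n + n)).setReg 0 (s₁.reg 18), t + (4 + 2), ?_,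
    (Nat.add_le_add_right ht 6).trans
      (time_bound C (WordRAM.LoopProg.findRoot_depth hk)), fun hcl => ?_, fun hcl => ?_⟩
  · refine .seq _ _ _ _ _ _ _ hexec (.seq _ _ _ (s₁.setReg 1 (n + n)) _ 4 2 ?_ ?_)
    · have := WordRAM.Exec.assign (W := (n + 2) ^ (w + a)) 1 (.bin .add (.reg 0) (.reg 0)) s₁
        ⟨(hb'.1 0).trans_le hMW, (hb'.1 0).trans_le hMW, ?_⟩
      · have e : (WordRAM.Exp.bin .add (.reg 0) (.reg 0)).value s₁ = n + n := by
          rw [← h0]; rfl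
        rw [e] at this
        exact this
      · simp only [WordRAM.Exp.value_reg, WordRAM.BinOp.apply, h0]
        omega
    · exact WordRAM.Exec.assign (W := (n + 2) ^ (w + a)) 0 (.reg 18) (s₁.setReg 1 (n + n))
        ((hb'.1 18).trans_le hMW)
  · rcases hroot with hroot | ⟨hroot, hdesc⟩
    · exact absurd hcl hroot.2
    · refine ⟨by simp [hroot], ?_⟩
      have hp : ((s₁.setReg 1 (n + n)).setReg 0 (s₁.reg 18)).reg 1 = 2 * n := by
        simp [two_mul]
      unfold OutputsRoot
      rw [hp]
      exact hdesc
  · rcases hroot with hroot | ⟨hroot, H, φ, ι, hφ, -⟩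
    · simp [hroot.1]
    · exact absurd ⟨Fin (2 * n), inferInstance, H, φ, hφ, ⟨ι⟩⟩ hcl
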